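/- Fix integers $N\ge 0$, $d\ge 2$, $k\ge 0$ and the alphabet $\mathcal A_d=\{0,\dots,d-1\}$. For a word $i\in\mathcal A_d^N$ and $t\subseteq\{1,\dots,N\}$ let $i_t$ and $i_{-t}$ be the substrings of $i$ on $t$ and on its complement. A classical sampling strategy $\Psi$ consists of a probability distribution $P_T$ on the subsets of $\{1,\dots,N\}$, a guess function $f:\mathcal A_d^*\to\mathbb R^k$ and a target function $g:\mathcal A_d^*\to\mathbb R^k$. For $\delta>0$ its error probability is $$\epsilon^{cl}_\delta=\max_{i\in\mathcal A_d^N}\Pr_{t\sim P_T}\bigl(i\notin\mathcal G_{t,\delta}\bigr),\qquad \mathcal G_{t,\delta}=\Bigl\{i\in\mathcal A_d^N : \max_j|f_j(i_t)-g_j(i_{-t})|\le\delta\Bigr\}.$$ For a density operator $\rho_{AE}$ let $$H_{\min}(A|E)_\rho=\sup_{\sigma_E}\max\{\lambda\in\mathbb R : 2^{-\lambda}I_A\otimes\sigma_E-\rho_{AE}\ge 0\},\qquad H^{r}_{\min}(A|E)_\rho=\sup_{\sigma:\,\|\rho-\sigma\|_1\le r}H_{\min}(A|E)_\sigma,$$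 where $\sigma_E$ and $\sigma=\sigma_{AE}$ range over density operators and $\|\cdot\|_1$ is the trace norm. If $A$ consists of qudits and $Z$ is an orthonormal basis of $\mathcal H_d=\mathbb C^d$, then $H^r_{\min}(Z|E)_\rho$ is $H^r_{\min}(A|E)$ of the state obtained from $\rho$ by measuring every qudit of $A$ in the basis $Z$. Let $X=\{|x_b\rangle\}$ be a further orthonormal basis of $\mathcal H_d$. The experiment $\mathbf{Exp}$, run on a state on $\mathcal H_T\otimes\mathcal H_A\otimes\mathcal H_E$, where $\mathcal H_A\cong\mathcal H_d^{\otimes N}$ and $\mathcal H_T$ has the orthonormal basis $\{|t\rangle : t\subseteq\{1,\dots,N\}\}$, measures $T$, obtaining $t$; then measures the qudits of $A$ indexed by $t$ in the basis $X$, obtaining $q\in\mathcal A_d^{|t|}$; and returns $(t,q,\rho(t,q))$, where $\rho(t,q)$ is the normalized post-measurement state of the $N-|t|$ unmeasured qudits and $E$. **Theorem.** Let $0<\beta<1/2$ and $\delta>0$, let $\Psi$ be a classical sampling strategy with error probability $\epsilon^{cl}_\delta$, and put $\epsilon=\sqrt{\epsilon^{cl}_\delta}$. Let $\rho_{AE}$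 be an arbitrary density operator on $\mathcal H_A\otimes\mathcal H_E$, where $\mathcal H_A\cong\mathcal H_d^{\otimes N}$ and $\mathcal H_E$ is any complex Hilbert space. Let $Z=\{|z_a\rangle\}$ and $X=\{|x_b\rangle\}$ be orthonormal bases of $\mathcal H_d$, and let $\gamma=-\log_2\max_{a,b}|\langle z_a|x_b\rangle|^2$. Let $(t,q,\rho(t,q))\leftarrow\mathbf{Exp}\bigl(\sum_tP_T(t)|t\rangle\langle t|\otimes\rho_{AE},X\bigr)$. Then $$\Pr\Bigl(H_{\min}^{4\epsilon+2\epsilon^\beta}(Z|E)_{\rho(t,q)}+\log_2|J_q^{(N-|t|)}|\ge(N-|t|)\gamma\Bigr)\ge 1-2\epsilon^{1-2\beta},$$ where the probability is over the outcome $(t,q)$ of the experiment, $$J_q^{(n)}=\Bigl\{i\in\mathcal A_d^{n} : \max_j|f_j(q)-g_j(i)|\le\delta\Bigr\},$$ and $\log_2 0=-\infty$. -/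

import Mathlib

open scoped ENNReal

/-! ### Operators, trace and trace norm on a Hilbert space -/

section Hilbert

variable {H : Type*} [NormedAddCommGroup H] [InnerProductSpace ℂ H] [CompleteSpace H]

/-- The trace `∑ b, ⟨b, T b⟩ ∈ [0, ∞]` of a positive operator `T` on a complex Hilbert space, computed
in some orthonormal (Hilbert) basis; for positive `T` the value does not depend on the basis. It is
only applied to positive operators. -/
noncomputable def posTrace (T : H →L[ℂ] H) : ℝ≥0∞ :=
  ∑' b : (exists_hilbertBasis ℂ H).choose, ENNReal.ofReal (inner ℂ (b : H) (T (b : H))).re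

/-- The trace norm `‖T‖₁ = tr |T|`, where `|T| = √(T† T)`. -/
noncomputable def traceNorm (T : H →L[ℂ] H) : ℝ≥0∞ :=
  posTrace (CFC.abs T)

/-- Density operators: positive operators of trace one. -/
def IsDensityOperator (ρ : H →L[ℂ] H) : Prop :=
  ρ.IsPositive ∧ posTrace ρ = 1

end Hilbert

/-! ### Composite systems `ℂ^W ⊗ E` -/

/-- The Hilbert space `ℂ^W ⊗ E`, realized as the Hilbert sum of copies of `E` indexed by the finite
set `W`: the vector `∑ w, |w⟩ ⊗ e w` is the family `e`. The second system `E` is an arbitrary Hilbert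
space. -/
abbrev Composite (W : Type*) (E : Type*) : Type _ := PiLp 2 (fun _ : W => E)

section Composite

variable {W W' : Type*} [Fintype W]
variable {E : Type*} [NormedAddCommGroup E] [InnerProductSpace ℂ E]

/-- The operator `M ⊗ S : ℂ^W ⊗ E → ℂ^W' ⊗ E`. -/
noncomputable def opTensor (M : Matrix W' W ℂ) (S : E →L[ℂ] E) :
    Composite W E →L[ℂ] Composite W' E :=
  ((PiLp.continuousLinearEquiv 2 ℂ (fun _ : W' => E)).symm :
      (W' → E) →L[ℂ] Composite W' E) ∘L
    ContinuousLinearMap.pi (fun w' : W' =>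
      ∑ w : W, M w' w • (S ∘L PiLp.proj (𝕜 := ℂ) 2 (fun _ : W => E) w))

theorem opTensor_apply (M : Matrix W' W ℂ) (S : E →L[ℂ] E) (ψ : Composite W E) (w' : W') :
    opTensor M S ψ w' = ∑ w : W, M w' w • S (ψ w) := by
  simp [opTensor]

variable [Fintype W'] [CompleteSpace E]

/-- `(M ⊗ 1) ρ (M ⊗ 1)†`. -/
noncomputable def conjBy (M : Matrix W' W ℂ) (ρ : Composite W E →L[ℂ] Composite W E) :
    Composite W' E →L[ℂ] Composite W' E :=
  opTensor M (ContinuousLinearMap.id ℂ E) ∘L ρ ∘L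
    ContinuousLinearMap.adjoint (opTensor M (ContinuousLinearMap.id ℂ E))

/-! ### Conditional min-entropy -/

open Classical in
/-- `H_min(A|E)_ρ = sup_{σ_E} max {lam ∈ ℝ | 2^{-lam} 1_A ⊗ σ_E - ρ_{AE} ≥ 0}`, the supremum being over
density operators `σ_E` on `E`. The value is an extended real number (`-∞` for an empty set). -/
noncomputable def minEntropy (ρ : Composite W E →L[ℂ] Composite W E) : EReal :=
  ⨆ (σ : E →L[ℂ] E) (_ : IsDensityOperator σ),
    sSup ((fun lam : ℝ => (lam : EReal)) ''
      {lam : ℝ | ((((2 : ℝ) ^ (-lam) : ℝ) : ℂ) • opTensor (1 : Matrix W W ℂ) σ - ρ).IsPositive})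

/-- `H_min^r(A|E)_ρ = sup {H_min(A|E)_σ | σ a density operator with ‖ρ - σ‖₁ ≤ r}`. -/
noncomputable def smoothMinEntropy (r : ℝ) (ρ : Composite W E →L[ℂ] Composite W E) : EReal :=
  ⨆ (σ : Composite W E →L[ℂ] Composite W E)
    (_ : IsDensityOperator σ ∧ traceNorm (ρ - σ) ≤ ENNReal.ofReal r), minEntropy σ

end Composite

/-! ### Words, substrings and product bases -/

/-- The substring `w_t` of `w` on the positions in `t`, read in increasing order. -/
def substr {N d : ℕ} (t : Finset (Fin N)) (w : Fin N → Fin d) : Fin t.card → Fin d :=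
  fun i => w (t.orderEmbOfFin rfl i)

/-- Coordinates, in the computational basis of `(ℂ^d)^{⊗ n}` (indexed by words), of the product vector
`|v_i⟩ = |v_{i_1}⟩ ⊗ ⋯ ⊗ |v_{i_n}⟩`. -/
noncomputable def productKet {n d : ℕ} (v : OrthonormalBasis (Fin d) ℂ (EuclideanSpace ℂ (Fin d)))
    (i : Fin n → Fin d) : (Fin n → Fin d) → ℂ :=
  fun w => ∏ j, v (i j) (w j)

/-! ### Classical sampling strategies -/

/-- A classical sampling strategy for words of length `N` over an alphabet with `d` characters: the
distribution `P_T` of the sampled set of positions, the guess function `f : A_d^* → ℝ^k` to be evaluated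
on the observed substring, and the target function `g : A_d^* → ℝ^k` to be evaluated on the unobserved
substring. -/
structure SamplingStrategy (N d k : ℕ) where
  subsetLaw : PMF (Finset (Fin N))
  guess : (m : ℕ) → (Fin m → Fin d) → Fin k → ℝ
  target : (n : ℕ) → (Fin n → Fin d) → Fin k → ℝ

namespace SamplingStrategy

variable {N d k : ℕ}

/-- The set of good words
`G_{t,δ} = {i ∈ A_d^N | max_j |f_j(i_t) - g_j(i_{-t})| ≤ δ}`. -/
def goodWords (Ψ : SamplingStrategy N d k) (δ : ℝ) (t : Finset (Fin N)) : Set (Fin N → Fin d) :=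
  {i | ∀ j, |Ψ.guess t.card (substr t i) j - Ψ.target tᶜ.card (substr tᶜ i) j| ≤ δ}

open Classical in
/-- The error probability `ε_δ^cl(Ψ) = max_{i ∈ A_d^N} Pr_T (i ∉ G_{T,δ})`. -/
noncomputable def errorProb (Ψ : SamplingStrategy N d k) (δ : ℝ) : ℝ :=
  ⨆ i : Fin N → Fin d,
    ∑ t : Finset (Fin N), if i ∉ Ψ.goodWords δ t then (Ψ.subsetLaw t).toReal else 0

open Classical in
/-- The set `J_q^{(n)} = {i ∈ A_d^n | max_j |f_j(q) - g_j(i)| ≤ δ}`. -/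
noncomputable def closeWords (Ψ : SamplingStrategy N d k) (δ : ℝ) (n : ℕ) {m : ℕ}
    (q : Fin m → Fin d) : Finset (Fin n → Fin d) :=
  Finset.univ.filter (fun i => ∀ j, |Ψ.guess m q j - Ψ.target n i j| ≤ δ)

end SamplingStrategy

/-- `log₂ c` for a natural number `c`, with `log₂ 0 = -∞`. -/
noncomputable def log2Card (c : ℕ) : EReal :=
  if c = 0 then ⊥ else ((Real.logb 2 c : ℝ) : EReal)

/-! ### The sampling experiment -/

section Experiment

variable {N d : ℕ}
variable {E : Type*} [NormedAddCommGroup E] [InnerProductSpace ℂ E] [CompleteSpace E]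

/-- The isometry `|ψ⟩ ↦ |t⟩ ⊗ |ψ⟩` from `H_A` into `H_T ⊗ H_A`, where `H_T` has the orthonormal basis
`|t⟩`, `t ⊆ {1, …, N}`. -/
def attachSubset (t : Finset (Fin N)) :
    Matrix (Finset (Fin N) × (Fin N → Fin d)) (Fin N → Fin d) ℂ :=
  Matrix.of fun p w => if p.1 = t ∧ p.2 = w then 1 else 0

/-- The state `∑_t P(t) |t⟩⟨t| ⊗ ρ_{AE}`. -/
noncomputable def withSubset (P : PMF (Finset (Fin N)))
    (ρ : Composite (Fin N → Fin d) E →L[ℂ] Composite (Fin N → Fin d) E) :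
    Composite (Finset (Fin N) × (Fin N → Fin d)) E →L[ℂ]
      Composite (Finset (Fin N) × (Fin N → Fin d)) E :=
  ∑ t : Finset (Fin N), (((P t).toReal : ℝ) : ℂ) • conjBy (attachSubset t) ρ

/-- The operator `⟨t|_T ⊗ ⟨x_q|_{A_t} ⊗ 1_{A_{-t}}` from `H_T ⊗ H_A` to the space of the remaining qudits,
with the qudits outside `t` kept in increasing order. -/
noncomputable def outcomeOperator (X : OrthonormalBasis (Fin d) ℂ (EuclideanSpace ℂ (Fin d)))
    (t : Finset (Fin N)) (q : Fin t.card → Fin d) :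
    Matrix (Fin tᶜ.card → Fin d) (Finset (Fin N) × (Fin N → Fin d)) ℂ :=
  Matrix.of fun w' p =>
    if p.1 = t ∧ substr tᶜ p.2 = w' then star (productKet X q (substr t p.2)) else 0

/-- The probability that the experiment, run on `ρ_{TAE}` (measure `T`, obtaining `t`; measure the qudits
in `t` in the basis `X`, obtaining `q`), has outcome `(t, q)`. -/
noncomputable def outcomeProb
    (ρ : Composite (Finset (Fin N) × (Fin N → Fin d)) E →L[ℂ]
      Composite (Finset (Fin N) × (Fin N → Fin d)) E)
    (X : OrthonormalBasis (Fin d) ℂ (EuclideanSpace ℂ (Fin d)))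
    (t : Finset (Fin N)) (q : Fin t.card → Fin d) : ℝ :=
  (posTrace (conjBy (outcomeOperator X t q) ρ)).toReal

/-- The (normalized) post-measurement state `ρ(t, q)` of the unmeasured qudits and of `E`. -/
noncomputable def postState
    (ρ : Composite (Finset (Fin N) × (Fin N → Fin d)) E →L[ℂ]
      Composite (Finset (Fin N) × (Fin N → Fin d)) E)
    (X : OrthonormalBasis (Fin d) ℂ (EuclideanSpace ℂ (Fin d)))
    (t : Finset (Fin N)) (q : Fin t.card → Fin d) :
    Composite (Fin tᶜ.card → Fin d) E →L[ℂ] Composite (Fin tᶜ.card → Fin d) E :=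
  (((outcomeProb ρ X t q)⁻¹ : ℝ) : ℂ) • conjBy (outcomeOperator X t q) ρ

open Classical in
/-- The probability, over the outcomes `(t, q)` of the experiment run on `ρ_{TAE}`, of an event. -/
noncomputable def experimentPr
    (ρ : Composite (Finset (Fin N) × (Fin N → Fin d)) E →L[ℂ]
      Composite (Finset (Fin N) × (Fin N → Fin d)) E)
    (X : OrthonormalBasis (Fin d) ℂ (EuclideanSpace ℂ (Fin d)))
    (event : (t : Finset (Fin N)) → (Fin t.card → Fin d) → Prop) : ℝ :=
  ∑ t : Finset (Fin N), ∑ q : Fin t.card → Fin d, if event t q then outcomeProb ρ X t q else 0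

/-- The state `∑_z (|z⟩⟨z| ⊗ 1) ρ (|z⟩⟨z| ⊗ 1)` after measuring `n` qudits in the product basis of `Z`. -/
noncomputable def measured {n : ℕ} (Z : OrthonormalBasis (Fin d) ℂ (EuclideanSpace ℂ (Fin d)))
    (ρ : Composite (Fin n → Fin d) E →L[ℂ] Composite (Fin n → Fin d) E) :
    Composite (Fin n → Fin d) E →L[ℂ] Composite (Fin n → Fin d) E :=
  ∑ i : Fin n → Fin d, conjBy (Matrix.vecMulVec (productKet Z i) (star (productKet Z i))) ρ

/-- `H_min^r(Z|E)_ρ`: the smooth conditional min-entropy of `ρ` after measuring the qudits in the basis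
`Z`. -/
noncomputable def smoothMinEntropyMeasured {n : ℕ} (r : ℝ)
    (Z : OrthonormalBasis (Fin d) ℂ (EuclideanSpace ℂ (Fin d)))
    (ρ : Composite (Fin n → Fin d) E →L[ℂ] Composite (Fin n → Fin d) E) : EReal :=
  smoothMinEntropy r (measured Z ρ)

end Experiment

/-- `γ = -log₂ max_{a,b} |⟨z_a|x_b⟩|²`. -/
noncomputable def overlapExponent {d : ℕ}
    (Z X : OrthonormalBasis (Fin d) ℂ (EuclideanSpace ℂ (Fin d))) : ℝ :=
  -Real.logb 2 (⨆ p : Fin d × Fin d, ‖inner ℂ (Z p.1) (X p.2)‖ ^ 2)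

/-! ### The trace of positive operators -/

section TraceTheory

open ContinuousLinearMap

variable {H K : Type*} [NormedAddCommGroup H] [InnerProductSpace ℂ H] [CompleteSpace H]
  [NormedAddCommGroup K] [InnerProductSpace ℂ K] [CompleteSpace K]

/-! Imagine that after the outcome `(t, q)` the remaining qudits are also measured in `X`. Together
with `q` this yields a word `i`, whose law is that of measuring all of `A` in `X` and hence does not
depend on `t`. So the probability that `i` is not in the good set of `t` is an average over `i` of
the classical error probabilities, and is at most `ε ^ 2` (`sum_farProb_le_errorProb`). Put `s = ε ^
(1 + 2β) / 2`. By Markov's inequality, outside a set of outcomes of probability at most `ε ^ 2 / s =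
2 ε ^ (1 - 2β)`, the conditional probability that the remaining word lies outside `J_q` is at most
`s`.

For such an outcome let `P` project onto the span of the `|x_j⟩` with `j ∈ J_q`. The
post-measurement state passes `P` with probability `a ≥ 1 - s`, so by a gentle-measurement estimate
it is within `2√s + 2s` of `σ = PρP / a` in trace norm, also after measuring `Z`
(`gentle_measurement_bound`, `traceNorm_measured_le`). This radius fits in `4ε + 2ε ^ β`.

The state `σ` involves only `|J_q|` product vectors, each with squared overlap at most `2 ^ (-nγ)`
with every `|z_i⟩`, where `n` is the number of remaining qudits. Cauchy–Schwarz then bounds the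
measured state by `|J_q| 2 ^ (-nγ) 1 ⊗ τ` (`measured_sandwich_wordProjection_le`), which is the
entropy bound (`le_smoothMinEntropyMeasured_add_log2Card`).

Since `E` is arbitrary, traces take values in `[0, ∞]`, and cyclicity is only used in the form `tr
A†A = tr AA†`. -/

omit [CompleteSpace H] in
theorem HilbertBasis.ofReal_norm_sq_eq_tsum {ι : Type*} (b : HilbertBasis ι ℂ H) (x : H) :
    ENNReal.ofReal (‖x‖ ^ 2) = ∑' i, ENNReal.ofReal (‖inner ℂ (b i) x‖ ^ 2) := by
  have h := Complex.hasSum_re (b.hasSum_inner_mul_inner x x)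
  have e : ∀ i, (inner ℂ x (b i) * inner ℂ (b i) x).re = ‖inner ℂ (b i) x‖ ^ 2 := by
    intro i
    rw [← inner_conj_symm x (b i), ← Complex.normSq_eq_conj_mul_self, Complex.ofReal_re,
      Complex.normSq_eq_norm_sq]
  simp only [e] at h
  have h2 : (inner ℂ x x).re = ‖x‖ ^ 2 := inner_self_eq_norm_sq (𝕜 := ℂ) x
  rw [h2] at h
  rw [← h.tsum_eq, ENNReal.ofReal_tsum_of_nonneg (fun i => by positivity) h.summable]

/-- By Parseval both sides are the double sum of `|⟨c_j, A b_i⟩|²`, and Tonelli swaps the order of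
summation. -/
theorem posTrace_adjoint_comp (A : H →L[ℂ] K) :
    posTrace (adjoint A ∘L A) = posTrace (A ∘L adjoint A) := by
  obtain ⟨b, hb⟩ := (exists_hilbertBasis ℂ H).choose_spec
  obtain ⟨c, hc⟩ := (exists_hilbertBasis ℂ K).choose_spec
  have h1 : ∀ x : H, (inner ℂ x ((adjoint A ∘L A) x)).re = ‖A x‖ ^ 2 := by
    intro x
    rw [comp_apply, adjoint_inner_right]
    exact inner_self_eq_norm_sq (𝕜 := ℂ) (A x)
  have h2 : ∀ y : K, (inner ℂ y ((A ∘L adjoint A) y)).re = ‖adjoint A y‖ ^ 2 := by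
    intro y
    rw [comp_apply, ← adjoint_inner_left]
    exact inner_self_eq_norm_sq (𝕜 := ℂ) (adjoint A y)
  unfold posTrace
  simp only [h1, h2, c.ofReal_norm_sq_eq_tsum, b.ofReal_norm_sq_eq_tsum, hb, hc]
  rw [ENNReal.tsum_comm]
  refine tsum_congr fun y => tsum_congr fun x => ?_
  rw [adjoint_inner_right, norm_inner_symm]

omit [CompleteSpace H] in
theorem re_inner_nonneg_of_nonneg {T : H →L[ℂ] H} (hT : 0 ≤ T) (x : H) :
    0 ≤ (inner ℂ x (T x)).re :=
  ((nonneg_iff_isPositive T).1 hT).re_inner_nonneg_right x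

theorem posTrace_add {S T : H →L[ℂ] H} (hS : 0 ≤ S) (hT : 0 ≤ T) :
    posTrace (S + T) = posTrace S + posTrace T := by
  unfold posTrace
  rw [← ENNReal.tsum_add]
  refine tsum_congr fun x => ?_
  rw [← ENNReal.ofReal_add (re_inner_nonneg_of_nonneg hS _) (re_inner_nonneg_of_nonneg hT _)]
  simp

theorem posTrace_mono {S T : H →L[ℂ] H} (h : S ≤ T) : posTrace S ≤ posTrace T := by
  refine ENNReal.tsum_le_tsum fun x => ENNReal.ofReal_le_ofReal ?_
  have := re_inner_nonneg_of_nonneg (sub_nonneg.2 h) (x : H)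
  simpa [inner_sub_right] using this

@[simp]
theorem posTrace_zero : posTrace (0 : H →L[ℂ] H) = 0 := by
  simp [posTrace]

theorem posTrace_sum {ι : Type*} (s : Finset ι) (T : ι → H →L[ℂ] H) (hT : ∀ i, 0 ≤ T i) :
    posTrace (∑ i ∈ s, T i) = ∑ i ∈ s, posTrace (T i) := by
  classical
  induction s using Finset.induction_on with
  | empty => simp
  | insert i s hi ih =>
    rw [Finset.sum_insert hi, Finset.sum_insert hi,
      posTrace_add (hT i) (Finset.sum_nonneg fun j _ => hT j), ih]

theorem posTrace_smul {c : ℝ} (hc : 0 ≤ c) (T : H →L[ℂ] H) :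
    posTrace ((c : ℂ) • T) = ENNReal.ofReal c * posTrace T := by
  unfold posTrace
  rw [← ENNReal.tsum_mul_left]
  refine tsum_congr fun x => ?_
  rw [← ENNReal.ofReal_mul hc]
  simp

/-- The operator `B T B†`. -/
noncomputable def sandwich (B : H →L[ℂ] K) (T : H →L[ℂ] H) : K →L[ℂ] K :=
  B ∘L T ∘L adjoint B

theorem sandwich_nonneg (B : H →L[ℂ] K) {T : H →L[ℂ] H} (hT : 0 ≤ T) : 0 ≤ sandwich B T := by
  rw [nonneg_iff_isPositive] at *
  exact hT.conj_adjoint B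

theorem sandwich_one (T : H →L[ℂ] H) : sandwich 1 T = T := by
  ext x
  simp [sandwich, adjoint_one]

theorem sandwich_add (B : H →L[ℂ] K) (S T : H →L[ℂ] H) :
    sandwich B (S + T) = sandwich B S + sandwich B T := by
  simp [sandwich]

theorem sandwich_sub (B : H →L[ℂ] K) (S T : H →L[ℂ] H) :
    sandwich B (S - T) = sandwich B S - sandwich B T := by
  simp [sandwich]

theorem sandwich_neg (B : H →L[ℂ] K) (T : H →L[ℂ] H) :
    sandwich B (-T) = -sandwich B T := by
  simp [sandwich]

theorem sandwich_smul (B : H →L[ℂ] K) (c : ℂ) (T : H →L[ℂ] H) :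
    sandwich B (c • T) = c • sandwich B T := by
  simp [sandwich]

theorem sandwich_zero (B : H →L[ℂ] K) : sandwich B (0 : H →L[ℂ] H) = 0 := by
  simp [sandwich]

theorem sandwich_sum {ι : Type*} (B : H →L[ℂ] K) (s : Finset ι) (T : ι → H →L[ℂ] H) :
    sandwich B (∑ i ∈ s, T i) = ∑ i ∈ s, sandwich B (T i) := by
  classical
  induction s using Finset.induction_on with
  | empty => simp [sandwich_zero]
  | insert i s hi ih => rw [Finset.sum_insert hi, Finset.sum_insert hi, sandwich_add, ih]

theorem sandwich_mono (B : H →L[ℂ] K) {S T : H →L[ℂ] H} (h : S ≤ T) :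
    sandwich B S ≤ sandwich B T := by
  rw [← sub_nonneg, ← sandwich_sub]
  exact sandwich_nonneg B (sub_nonneg.2 h)

theorem sandwich_comp {L : Type*} [NormedAddCommGroup L] [InnerProductSpace ℂ L] [CompleteSpace L]
    (C : K →L[ℂ] L) (B : H →L[ℂ] K) (T : H →L[ℂ] H) :
    sandwich (C ∘L B) T = sandwich C (sandwich B T) := by
  simp only [sandwich, adjoint_comp, comp_assoc]

/-- Cyclicity applied to `B √T`. It shows that the trace depends on `B` only through `B†B`. -/
theorem posTrace_sandwich (B : H →L[ℂ] K) {T : H →L[ℂ] H} (hT : 0 ≤ T) :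
    posTrace (sandwich B T) = posTrace (sandwich (CFC.sqrt T) (adjoint B ∘L B)) := by
  have hs : adjoint (CFC.sqrt T) = CFC.sqrt T := (IsSelfAdjoint.of_nonneg (CFC.sqrt_nonneg T))
  have hT' : CFC.sqrt T ∘L CFC.sqrt T = T := CFC.sqrt_mul_sqrt_self T hT
  have h := posTrace_adjoint_comp (B ∘L CFC.sqrt T)
  rw [adjoint_comp, hs] at h
  rw [sandwich, sandwich, hs]
  nth_rw 1 [← hT']
  simp only [comp_assoc] at h ⊢
  exact h.symm

theorem adjoint_comp_self_nonneg (B : H →L[ℂ] K) : 0 ≤ adjoint B ∘L B := by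
  rw [nonneg_iff_isPositive]
  exact isPositive_adjoint_comp_self B

/-- Two measurements whose Kraus operators have the same total effect have the same total
probability, even if their outputs live in different spaces. -/
theorem sum_posTrace_sandwich {ι κ : Type*} [Fintype ι] [Fintype κ] {K : ι → Type*} {L : κ → Type*}
    [∀ i, NormedAddCommGroup (K i)] [∀ i, InnerProductSpace ℂ (K i)] [∀ i, CompleteSpace (K i)]
    [∀ j, NormedAddCommGroup (L j)] [∀ j, InnerProductSpace ℂ (L j)] [∀ j, CompleteSpace (L j)]
    (B : ∀ i, H →L[ℂ] K i) (C : ∀ j, H →L[ℂ] L j)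
    (h : ∑ i, adjoint (B i) ∘L B i = ∑ j, adjoint (C j) ∘L C j)
    {T : H →L[ℂ] H} (hT : 0 ≤ T) :
    ∑ i, posTrace (sandwich (B i) T) = ∑ j, posTrace (sandwich (C j) T) := by
  simp only [posTrace_sandwich _ hT]
  rw [← posTrace_sum _ _ fun i => sandwich_nonneg _ (adjoint_comp_self_nonneg (B i)),
    ← posTrace_sum _ _ fun i => sandwich_nonneg _ (adjoint_comp_self_nonneg (C i)),
    ← sandwich_sum, ← sandwich_sum, h]

theorem sum_posTrace_sandwich_of_resolution {ι : Type*} [Fintype ι] {K : ι → Type*}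
    [∀ i, NormedAddCommGroup (K i)] [∀ i, InnerProductSpace ℂ (K i)] [∀ i, CompleteSpace (K i)]
    (B : ∀ i, H →L[ℂ] K i) (h : ∑ i, adjoint (B i) ∘L B i = 1)
    {T : H →L[ℂ] H} (hT : 0 ≤ T) :
    ∑ i, posTrace (sandwich (B i) T) = posTrace T := by
  have := sum_posTrace_sandwich (κ := Unit) B (fun _ => (1 : H →L[ℂ] H))
    (by rw [h]; simp only [Fintype.sum_unique, adjoint_one]; rfl) hT
  simpa [sandwich_one] using this

theorem posTrace_sandwich_add_le {Q u v : H →L[ℂ] H} (hQ : 0 ≤ Q)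
    (h : adjoint u ∘L u + adjoint v ∘L v ≤ 1) :
    posTrace (sandwich u Q + sandwich v Q) ≤ posTrace Q := by
  rw [posTrace_add (sandwich_nonneg u hQ) (sandwich_nonneg v hQ), posTrace_sandwich _ hQ,
    posTrace_sandwich _ hQ, ← posTrace_add (sandwich_nonneg _ (adjoint_comp_self_nonneg u))
      (sandwich_nonneg _ (adjoint_comp_self_nonneg v)), ← sandwich_add]
  refine (posTrace_mono (sandwich_mono _ h)).trans_eq ?_
  have := posTrace_sandwich (1 : H →L[ℂ] H) hQ
  rw [sandwich_one, adjoint_one] at this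
  exact this.symm

/-- `|D|` is approximated from below by `u D u - v D v` with `u² + v² ≤ 1`. -/
theorem exists_abs_le_sandwich {D : H →L[ℂ] H} (hD : IsSelfAdjoint D) {c : ℝ} (hc : 0 < c) :
    ∃ u v : H →L[ℂ] H, adjoint u ∘L u + adjoint v ∘L v ≤ 1 ∧
      CFC.abs D ≤ sandwich u D - sandwich v D + (c : ℂ) • (1 : H →L[ℂ] H) := by
  -- These are continuous substitutes for the square roots of the indicators of `x > 0` and `x < 0`.
  -- They differ from the indicators only where `|x| < c`, so replacing `|x|` by `x f² - x g²` costs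
  -- at most `c`.
  set f : ℝ → ℝ := fun x => √(min 1 (max x 0 / c)) with hf
  set g : ℝ → ℝ := fun x => √(min 1 (max (-x) 0 / c)) with hg
  have hfc : Continuous f := by fun_prop
  have hgc : Continuous g := by fun_prop
  have hu : IsSelfAdjoint (cfc f D) := cfc_predicate f D
  have hv : IsSelfAdjoint (cfc g D) := cfc_predicate g D
  have huu : adjoint (cfc f D) = cfc f D := hu
  have hvv : adjoint (cfc g D) = cfc g D := hv
  have hfs : ∀ x, f x * f x = min 1 (max x 0 / c) := fun x =>
    Real.mul_self_sqrt (by positivity)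
  have hgs : ∀ x, g x * g x = min 1 (max (-x) 0 / c) := fun x =>
    Real.mul_self_sqrt (by positivity)
  refine ⟨cfc f D, cfc g D, ?_, ?_⟩
  · rw [huu, hvv]
    change cfc f D * cfc f D + cfc g D * cfc g D ≤ 1
    rw [← cfc_mul f f D hfc.continuousOn hfc.continuousOn,
      ← cfc_mul g g D hgc.continuousOn hgc.continuousOn,
      ← cfc_add D (fun x => f x * f x) (fun x => g x * g x) (by fun_prop) (by fun_prop)]
    refine cfc_le_one _ D fun x _ => ?_
    simp only [hfs, hgs]
    rcases le_total 0 x with h | h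
    · rw [max_eq_right (by linarith : -x ≤ 0)]; simp
    · rw [max_eq_right h]; simp
  · have e1 : sandwich (cfc f D) D = cfc (fun x => f x * (x * f x)) D := by
      rw [cfc_mul f (fun x => x * f x) D hfc.continuousOn (by fun_prop),
        cfc_mul (fun x => x) f D (by fun_prop) hfc.continuousOn, cfc_id' ℝ D, sandwich, huu]
      rfl
    have e2 : sandwich (cfc g D) D = cfc (fun x => g x * (x * g x)) D := by
      rw [cfc_mul g (fun x => x * g x) D hgc.continuousOn (by fun_prop),
        cfc_mul (fun x => x) g D (by fun_prop) hgc.continuousOn, cfc_id' ℝ D, sandwich, hvv]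
      rfl
    have e3 : (c : ℂ) • (1 : H →L[ℂ] H) = cfc (fun _ : ℝ => c) D := by
      rw [cfc_const c D, Algebra.algebraMap_eq_smul_one]
      rfl
    rw [CFC.abs_eq_cfc_norm D hD, e1, e2, e3,
      ← cfc_sub (fun x => f x * (x * f x)) (fun x => g x * (x * g x)) D (by fun_prop)
        (by fun_prop),
      ← cfc_add D (fun x => f x * (x * f x) - g x * (x * g x)) (fun _ => c) (by fun_prop)
        (by fun_prop)]
    refine cfc_mono (fun x _ => ?_) (by fun_prop) (by fun_prop)
    have hx : f x * (x * f x) - g x * (x * g x) = x * (f x * f x) - x * (g x * g x) := by ring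
    have key : ∀ y : ℝ, 0 ≤ y → y ≤ y * min 1 (y / c) + c := by
      intro y hy
      rcases le_total 1 (y / c) with h | h
      · rw [min_eq_left h]; linarith
      · rw [min_eq_right h]
        have : y ≤ c := by rwa [div_le_one hc] at h
        have : 0 ≤ y * (y / c) := by positivity
        linarith
    rw [hx, hfs, hgs, Real.norm_eq_abs]
    rcases le_total 0 x with h | h
    · rw [abs_of_nonneg h, max_eq_left h, max_eq_right (by linarith : -x ≤ 0)]
      simpa using key x h
    · rw [abs_of_nonpos h, max_eq_right h, max_eq_left (by linarith : 0 ≤ -x)]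
      simpa using key (-x) (by linarith)

/-- With `u`, `v` approximating the positive and negative spectral projections of `D`, `|D|` is
nearly `uDu - vDv ≤ uQu + vQv`, whose trace is at most `tr Q` because `u² + v² ≤ 1`. -/
theorem traceNorm_le_posTrace {D Q : H →L[ℂ] H} (h1 : D ≤ Q) (h2 : -D ≤ Q) :
    traceNorm D ≤ posTrace Q := by
  have hQ : 0 ≤ Q := by
    have h : 0 ≤ (2 : ℝ) • Q := by
      rw [two_smul]
      simpa using add_le_add h1 h2
    simpa [smul_smul] using smul_nonneg (by norm_num : (0 : ℝ) ≤ 1 / 2) h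
  have hD : IsSelfAdjoint D := by
    have := (IsSelfAdjoint.of_nonneg hQ).sub (IsSelfAdjoint.of_nonneg (sub_nonneg.2 h1))
    simpa using this
  obtain ⟨b, hb⟩ := (exists_hilbertBasis ℂ H).choose_spec
  have hn : ∀ x : (exists_hilbertBasis ℂ H).choose, ‖(x : H)‖ = 1 := by
    intro x
    have := b.orthonormal.1 x
    rwa [hb] at this
  unfold traceNorm
  rw [posTrace, ENNReal.tsum_eq_iSup_sum]
  -- The error term `c • 1` may have infinite trace, so only finite partial sums are compared, with
  -- `c` chosen after `F` so that the total error is at most `e`.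
  refine iSup_le fun F => ENNReal.le_of_forall_pos_le_add fun e he _ => ?_
  obtain ⟨u, v, huv, habs⟩ := exists_abs_le_sandwich hD
    (c := (e : ℝ) / (F.card + 1)) (by positivity)
  set c : ℝ := (e : ℝ) / (F.card + 1)
  have hc : 0 ≤ c := by positivity
  have hR0 : 0 ≤ sandwich u Q + sandwich v Q :=
    add_nonneg (sandwich_nonneg u hQ) (sandwich_nonneg v hQ)
  have hR : CFC.abs D ≤ sandwich u Q + sandwich v Q + (c : ℂ) • (1 : H →L[ℂ] H) := by
    refine habs.trans (add_le_add_left ?_ _)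
    rw [sub_eq_add_neg, ← sandwich_neg]
    exact add_le_add (sandwich_mono u h1) (sandwich_mono v h2)
  have hx : ∀ x ∈ F, ENNReal.ofReal (inner ℂ (x : H) (CFC.abs D (x : H))).re ≤
      ENNReal.ofReal (inner ℂ (x : H) ((sandwich u Q + sandwich v Q) (x : H))).re
        + ENNReal.ofReal c := by
    intro x _
    rw [← ENNReal.ofReal_add (re_inner_nonneg_of_nonneg hR0 _) hc]
    refine ENNReal.ofReal_le_ofReal ?_
    have h := re_inner_nonneg_of_nonneg (sub_nonneg.2 hR) (x : H)
    have hxx : inner ℂ (x : H) (x : H) = 1 := by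
      rw [inner_self_eq_norm_sq_to_K, hn x]; simp
    simp only [sub_apply, add_apply, smul_apply, one_apply_eq_self, inner_sub_right,
      inner_add_right, inner_smul_right, hxx, Complex.sub_re, Complex.add_re, mul_one,
      Complex.ofReal_re] at h ⊢
    linarith
  refine (Finset.sum_le_sum hx).trans ?_
  rw [Finset.sum_add_distrib]
  refine add_le_add ((ENNReal.sum_le_tsum F).trans (posTrace_sandwich_add_le hQ huv)) ?_
  rw [Finset.sum_const, nsmul_eq_mul, ← ENNReal.ofReal_natCast, ← ENNReal.ofReal_mul (by positivity),
    ← ENNReal.ofReal_coe_nnreal]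
  refine ENNReal.ofReal_le_ofReal ?_
  have : (F.card : ℝ) * c ≤ (F.card + 1) * c := by nlinarith
  refine this.trans_eq ?_
  simp only [c]
  field_simp

end TraceTheory

/-! ### Bras, kets and operators on `ℂ^W ⊗ E` -/

section Kets

open ContinuousLinearMap
open scoped Matrix

variable {W W' W'' : Type*} [Fintype W] [Fintype W'] [Fintype W'']
variable {E : Type*} [NormedAddCommGroup E] [InnerProductSpace ℂ E]

omit [Fintype W''] in
theorem opTensor_comp (M : Matrix W'' W' ℂ) (M' : Matrix W' W ℂ) (S S' : E →L[ℂ] E) :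
    opTensor M S ∘L opTensor M' S' = opTensor (M * M') (S ∘L S') := by
  ext ψ w
  simp only [comp_apply, opTensor_apply, Matrix.mul_apply, map_sum, map_smul, Finset.smul_sum,
    Finset.sum_smul, smul_smul]
  exact Finset.sum_comm

theorem opTensor_add (M M' : Matrix W' W ℂ) (S : E →L[ℂ] E) :
    opTensor (M + M') S = opTensor M S + opTensor M' S := by
  ext ψ w
  simp [opTensor_apply, add_smul, Finset.sum_add_distrib]

omit [Fintype W'] in
theorem opTensor_zero (S : E →L[ℂ] E) : opTensor (0 : Matrix W' W ℂ) S = 0 := by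
  ext ψ w
  simp [opTensor_apply]

theorem opTensor_smul_right (c : ℂ) (M : Matrix W' W ℂ) (S : E →L[ℂ] E) :
    opTensor M (c • S) = c • opTensor M S := by
  ext ψ w
  simp [opTensor_apply, Finset.smul_sum, smul_smul, mul_comm]

theorem opTensor_sum {ι : Type*} (s : Finset ι) (M : ι → Matrix W' W ℂ) (S : E →L[ℂ] E) :
    opTensor (∑ i ∈ s, M i) S = ∑ i ∈ s, opTensor (M i) S := by
  classical
  induction s using Finset.induction_on with
  | empty => simp [opTensor_zero]
  | insert i s hi ih => rw [Finset.sum_insert hi, Finset.sum_insert hi, opTensor_add, ih]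

theorem opTensor_one [DecidableEq W] :
    opTensor (1 : Matrix W W ℂ) (ContinuousLinearMap.id ℂ E) = 1 := by
  ext ψ w
  simp [opTensor_apply, Matrix.one_apply]

/-- The operator `⟨v| ⊗ 1 : ℂ^W ⊗ E → E`. -/
noncomputable def bra (v : W → ℂ) : Composite W E →L[ℂ] E :=
  ∑ w, star (v w) • PiLp.proj (𝕜 := ℂ) 2 (fun _ : W => E) w

theorem bra_apply (v : W → ℂ) (ψ : Composite W E) : bra v ψ = ∑ w, star (v w) • ψ w := by
  simp [bra]

theorem bra_comp_opTensor (v : W' → ℂ) (M : Matrix W' W ℂ) :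
    bra v ∘L opTensor M (ContinuousLinearMap.id ℂ E) = bra (Mᴴ *ᵥ v) := by
  ext ψ
  simp only [comp_apply, bra_apply, opTensor_apply, Matrix.mulVec, dotProduct,
    Matrix.conjTranspose_apply, star_sum, star_mul', star_star, Finset.sum_smul, Finset.smul_sum,
    smul_smul, id_apply]
  rw [Finset.sum_comm]
  simp only [mul_comm]

variable [CompleteSpace E]

theorem adjoint_bra_apply (v : W → ℂ) (e : E) (w : W) : adjoint (bra v) e w = v w • e := by
  classical
  have : adjoint (bra v) e = WithLp.toLp 2 (fun w => v w • e) := by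
    refine ext_inner_right ℂ fun ψ => ?_
    rw [adjoint_inner_left, bra_apply, PiLp.inner_apply]
    simp [inner_sum, inner_smul_left, inner_smul_right]
  rw [this]

theorem adjoint_bra_comp_bra (v : W → ℂ) :
    adjoint (bra v) ∘L bra v =
      opTensor (Matrix.vecMulVec v (star v)) (ContinuousLinearMap.id ℂ E) := by
  ext ψ w
  simp [adjoint_bra_apply, bra_apply, opTensor_apply, Matrix.vecMulVec_apply, smul_smul,
    mul_comm]

theorem sandwich_adjoint_bra (v : W → ℂ) (S : E →L[ℂ] E) :
    sandwich (adjoint (bra v)) S = opTensor (Matrix.vecMulVec v (star v)) S := by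
  ext ψ w
  simp [sandwich, adjoint_bra_apply, bra_apply, opTensor_apply, Matrix.vecMulVec_apply,
    smul_smul, mul_comm]

theorem conjBy_eq_sandwich (M : Matrix W' W ℂ) (ρ : Composite W E →L[ℂ] Composite W E) :
    conjBy M ρ = sandwich (opTensor M (ContinuousLinearMap.id ℂ E)) ρ := rfl

theorem sandwich_smul_left {H K : Type*} [NormedAddCommGroup H] [InnerProductSpace ℂ H]
    [CompleteSpace H] [NormedAddCommGroup K] [InnerProductSpace ℂ K] [CompleteSpace K]
    (c : ℂ) (B : H →L[ℂ] K) (T : H →L[ℂ] H) :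
    sandwich (c • B) T = ((‖c‖ ^ 2 : ℝ) : ℂ) • sandwich B T := by
  simp only [sandwich, map_smulₛₗ, smul_comp, comp_smul, smul_smul]
  rw [← Complex.normSq_eq_conj_mul_self, Complex.normSq_eq_norm_sq]

/-- On a vector `y` this is Cauchy–Schwarz for `‖∑ √T B_i† y‖²`. The factor `|s|` becomes the term
`log₂ |J_q|` of the theorem. -/
theorem sandwich_sum_le {H K : Type*} [NormedAddCommGroup H] [InnerProductSpace ℂ H]
    [CompleteSpace H] [NormedAddCommGroup K] [InnerProductSpace ℂ K] [CompleteSpace K]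
    {ι : Type*} (s : Finset ι) (B : ι → H →L[ℂ] K) {T : H →L[ℂ] H} (hT : 0 ≤ T) :
    sandwich (∑ i ∈ s, B i) T ≤ (((s.card : ℝ)) : ℂ) • ∑ i ∈ s, sandwich (B i) T := by
  have hs : adjoint (CFC.sqrt T) = CFC.sqrt T := (IsSelfAdjoint.of_nonneg (CFC.sqrt_nonneg T))
  have hT' : CFC.sqrt T ∘L CFC.sqrt T = T := CFC.sqrt_mul_sqrt_self T hT
  have key : ∀ (C : H →L[ℂ] K) (y : K),
      (inner ℂ (sandwich C T y) y).re = ‖CFC.sqrt T (adjoint C y)‖ ^ 2 := by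
    intro C y
    rw [sandwich, comp_apply, comp_apply, ← adjoint_inner_right]
    nth_rw 1 [← hT']
    rw [comp_apply, ← adjoint_inner_right, hs]
    exact inner_self_eq_norm_sq (𝕜 := ℂ) _
  have h0 : 0 ≤ (((s.card : ℝ)) : ℂ) • ∑ i ∈ s, sandwich (B i) T := by
    rw [nonneg_iff_isPositive]
    refine IsPositive.smul_of_nonneg ?_ (by exact_mod_cast (Nat.cast_nonneg s.card : (0:ℝ) ≤ _))
    rw [← nonneg_iff_isPositive]
    exact Finset.sum_nonneg fun i _ => sandwich_nonneg _ hT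
  rw [le_def, isPositive_def']
  refine ⟨(IsSelfAdjoint.of_nonneg h0).sub (IsSelfAdjoint.of_nonneg (sandwich_nonneg _ hT)),
    fun y => ?_⟩
  have e : (inner ℂ ((∑ i ∈ s, sandwich (B i) T) y) y).re =
      ∑ i ∈ s, ‖CFC.sqrt T (adjoint (B i) y)‖ ^ 2 := by
    rw [sum_apply, sum_inner, Complex.re_sum]
    exact Finset.sum_congr rfl fun i _ => key (B i) y
  have h2 : ‖CFC.sqrt T (adjoint (∑ i ∈ s, B i) y)‖ ^ 2 ≤
      s.card * ∑ i ∈ s, ‖CFC.sqrt T (adjoint (B i) y)‖ ^ 2 := by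
    rw [map_sum, sum_apply, map_sum]
    refine le_trans (pow_le_pow_left₀ (norm_nonneg _) (norm_sum_le _ _) 2) ?_
    exact sq_sum_le_card_mul_sum_sq
  rw [reApplyInnerSelf_apply, sub_apply, inner_sub_left, smul_apply, inner_smul_left]
  simp only [Complex.conj_ofReal, map_sub, RCLike.re_to_complex, Complex.re_ofReal_mul, e, key]
  linarith

end Kets

/-! ### Min-entropy after a measurement -/

section Entropy

open ContinuousLinearMap
open scoped Matrix

theorem ofReal_smul_nonneg {H : Type*} [NormedAddCommGroup H] [InnerProductSpace ℂ H]
    [CompleteSpace H] {c : ℝ} (hc : 0 ≤ c) {T : H →L[ℂ] H} (hT : 0 ≤ T) : 0 ≤ (c : ℂ) • T := by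
  rw [nonneg_iff_isPositive] at *
  exact hT.smul_of_nonneg (by exact_mod_cast hc)

theorem ofReal_smul_le_smul {H : Type*} [NormedAddCommGroup H] [InnerProductSpace ℂ H]
    [CompleteSpace H] {c : ℝ} (hc : 0 ≤ c) {S T : H →L[ℂ] H} (h : S ≤ T) : (c : ℂ) • S ≤ (c : ℂ) • T := by
  rw [← sub_nonneg, ← smul_sub]
  exact ofReal_smul_nonneg hc (sub_nonneg.2 h)

theorem ofReal_smul_le_of_le {H : Type*} [NormedAddCommGroup H] [InnerProductSpace ℂ H]
    [CompleteSpace H] {c c' : ℝ} (hc : c ≤ c') {T : H →L[ℂ] H} (hT : 0 ≤ T) : (c : ℂ) • T ≤ (c' : ℂ) • T := by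
  rw [← sub_nonneg, ← sub_smul, ← Complex.ofReal_sub]
  exact ofReal_smul_nonneg (sub_nonneg.2 hc) hT

/-- For a projection `P` that the state `ρ` passes with probability `a`, the operators
`± (ρ - P ρ P / a)` are bounded by an operator of small trace. -/
theorem gentle_measurement_bound {H : Type*} [NormedAddCommGroup H] [InnerProductSpace ℂ H]
    [CompleteSpace H] {ρ P P' : H →L[ℂ] H} (hρ : 0 ≤ ρ) (hP : adjoint P = P)
    (hP' : adjoint P' = P') (hPP' : P + P' = 1) {a c : ℝ} (ha : 0 < a) (ha1 : a ≤ 1) (hc : 0 < c) :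
    ρ - ((a⁻¹ : ℝ) : ℂ) • sandwich P ρ ≤ ((c + (a⁻¹ - 1) : ℝ) : ℂ) • sandwich P ρ
        + ((1 + c⁻¹ : ℝ) : ℂ) • sandwich P' ρ ∧
      -(ρ - ((a⁻¹ : ℝ) : ℂ) • sandwich P ρ) ≤ ((c + (a⁻¹ - 1) : ℝ) : ℂ) • sandwich P ρ
        + ((1 + c⁻¹ : ℝ) : ℂ) • sandwich P' ρ := by
  have h1a : 0 ≤ a⁻¹ - 1 := sub_nonneg.2 ((one_le_inv₀ ha).2 ha1)
  have hdec : ρ = sandwich P ρ + P ∘L ρ ∘L P' + P' ∘L ρ ∘L P + sandwich P' ρ := by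
    have : ρ = (P + P') ∘L ρ ∘L (P + P') := by rw [hPP']; rfl
    nth_rw 1 [this]
    simp only [sandwich, hP, hP', add_comp, comp_add]
    abel
  have hs : ((√c : ℝ) : ℂ) * ((√c : ℝ) : ℂ) = (c : ℂ) := by
    rw [← Complex.ofReal_mul, Real.mul_self_sqrt hc.le]
  have hsi : ((√c⁻¹ : ℝ) : ℂ) * ((√c⁻¹ : ℝ) : ℂ) = ((c⁻¹ : ℝ) : ℂ) := by
    rw [← Complex.ofReal_mul, Real.mul_self_sqrt (by positivity)]
  have hm : ((√c : ℝ) : ℂ) * ((√c⁻¹ : ℝ) : ℂ) = 1 := by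
    rw [← Complex.ofReal_mul, ← Real.sqrt_mul hc.le, mul_inv_cancel₀ hc.ne']
    simp
  -- Conjugating `ρ` by `√c P + σ √c⁻¹ P'` with `σ = ±1` controls the off-diagonal blocks by the
  -- diagonal ones, with `c` free to balance the two.
  have key : ∀ σ : ℂ, star σ = σ → σ * σ = 1 →
      0 ≤ (c : ℂ) • sandwich P ρ + ((c⁻¹ : ℝ) : ℂ) • sandwich P' ρ
        + σ • (P ∘L ρ ∘L P' + P' ∘L ρ ∘L P) := by
    intro σ hσ hσσ
    have h := sandwich_nonneg (((√c : ℝ) : ℂ) • P + (σ * ((√c⁻¹ : ℝ) : ℂ)) • P') hρ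
    refine h.trans_eq ?_
    have hσ' : (starRingEnd ℂ) σ = σ := hσ
    simp only [sandwich, map_add, map_smulₛₗ, hP, hP', add_comp, comp_add, smul_comp, comp_smul,
      smul_smul, map_mul, Complex.conj_ofReal, hσ', smul_add]
    have e1 : ((√c : ℝ) : ℂ) * (σ * ((√c⁻¹ : ℝ) : ℂ)) = σ := by linear_combination σ * hm
    have e2 : σ * ((√c⁻¹ : ℝ) : ℂ) * ((√c : ℝ) : ℂ) = σ := by linear_combination σ * hm
    have e3 : σ * ((√c⁻¹ : ℝ) : ℂ) * (σ * ((√c⁻¹ : ℝ) : ℂ)) = ((c⁻¹ : ℝ) : ℂ) := by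
      linear_combination σ * σ * hsi + ((c⁻¹ : ℝ) : ℂ) * hσσ
    simp only [← mul_assoc] at e1 e2 e3
    have e1' : ((√c : ℝ) : ℂ) * σ * ((√c⁻¹ : ℝ) : ℂ) = σ := e1
    simp only [← mul_assoc, hs, e3, e1', e2]
    abel
  have hA := sandwich_nonneg P hρ
  have hB := sandwich_nonneg P' hρ
  generalize sandwich P ρ = A at *
  generalize sandwich P' ρ = B at *
  generalize P ∘L ρ ∘L P' = C at *
  generalize P' ∘L ρ ∘L P = C' at *
  subst hdec
  constructor
  · rw [← sub_nonneg]
    refine (add_nonneg (key (-1) (by simp) (by simp))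
      (ofReal_smul_nonneg (by linarith : 0 ≤ 2 * (a⁻¹ - 1)) hA)).trans_eq ?_
    push_cast
    module
  · rw [← sub_nonneg]
    refine (add_nonneg (key 1 (by simp) (by simp))
      (ofReal_smul_nonneg (by norm_num : (0 : ℝ) ≤ 2) hB)).trans_eq ?_
    push_cast
    module

end Entropy

/-! ### Product bases, projections onto sets of words, and measurement in `Z` -/

section ProductKets

open ContinuousLinearMap
open scoped Matrix

variable {n d : ℕ} (X Z : OrthonormalBasis (Fin d) ℂ (EuclideanSpace ℂ (Fin d)))

theorem star_productKet_dotProduct (i j : Fin n → Fin d) :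
    star (productKet Z i) ⬝ᵥ productKet X j = ∏ l, inner ℂ (Z (i l)) (X (j l)) := by
  have h : ∀ l, inner ℂ (Z (i l)) (X (j l)) = ∑ a, star (Z (i l) a) * X (j l) a := by
    intro l
    simp [PiLp.inner_apply, mul_comm]
  simp only [h, Finset.prod_univ_sum, Fintype.piFinset_univ, dotProduct, Pi.star_apply, productKet,
    star_prod, Finset.prod_mul_distrib]

theorem star_productKet_dotProduct_self (i j : Fin n → Fin d) :
    star (productKet X i) ⬝ᵥ productKet X j = if i = j then 1 else 0 := by
  rw [star_productKet_dotProduct]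
  simp only [orthonormal_iff_ite.1 X.orthonormal]
  split_ifs with h
  · simp [h]
  · obtain ⟨l, hl⟩ := Function.ne_iff.1 h
    exact Finset.prod_eq_zero (Finset.mem_univ l) (by simp [hl])

/-- Orthonormality says `U†U = 1` for the matrix `U` of product vectors. As `U` is square, `UU† =
1`, which is completeness. -/
theorem sum_vecMulVec_productKet :
    ∑ i : Fin n → Fin d, Matrix.vecMulVec (productKet X i) (star (productKet X i)) = 1 := by
  set U : Matrix (Fin n → Fin d) (Fin n → Fin d) ℂ := Matrix.of fun w i => productKet X i w
  have h : Uᴴ * U = 1 := by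
    ext i j
    rw [Matrix.one_apply, ← star_productKet_dotProduct_self X i j]
    simp [U, Matrix.mul_apply, dotProduct]
  rw [← mul_eq_one_comm.1 h]
  ext w w'
  simp [U, Matrix.mul_apply, Matrix.sum_apply, Matrix.vecMulVec_apply]

variable {E : Type*} [NormedAddCommGroup E] [InnerProductSpace ℂ E] [CompleteSpace E]

theorem bra_comp_adjoint_bra {W : Type*} [Fintype W] (v u : W → ℂ) :
    (bra v : Composite W E →L[ℂ] E) ∘L adjoint (bra u) =
      (star v ⬝ᵥ u) • ContinuousLinearMap.id ℂ E := by
  ext e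
  simp [bra_apply, adjoint_bra_apply, smul_smul, dotProduct, Finset.sum_smul]

/-- The projection onto the span of the product vectors `|x_j⟩`, `j ∈ J`, tensored with `E`. -/
noncomputable def wordProjection (J : Finset (Fin n → Fin d)) :
    Composite (Fin n → Fin d) E →L[ℂ] Composite (Fin n → Fin d) E :=
  ∑ j ∈ J, adjoint (bra (productKet X j)) ∘L bra (productKet X j)

theorem wordProjection_univ :
    (wordProjection X Finset.univ : Composite (Fin n → Fin d) E →L[ℂ] _) = 1 := by
  simp only [wordProjection, adjoint_bra_comp_bra]
  rw [← opTensor_sum, sum_vecMulVec_productKet, opTensor_one]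

theorem adjoint_wordProjection (J : Finset (Fin n → Fin d)) :
    adjoint (wordProjection X J : Composite (Fin n → Fin d) E →L[ℂ] _) = wordProjection X J := by
  simp only [wordProjection, map_sum, adjoint_comp, adjoint_adjoint]

theorem bra_comp_wordProjection (J : Finset (Fin n → Fin d)) (v : (Fin n → Fin d) → ℂ) :
    (bra v : Composite (Fin n → Fin d) E →L[ℂ] E) ∘L wordProjection X J =
      ∑ j ∈ J, (star v ⬝ᵥ productKet X j) • bra (productKet X j) := by
  simp only [wordProjection, comp_finsetSum, ← comp_assoc, bra_comp_adjoint_bra, smul_comp,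
    id_comp]

theorem wordProjection_comp_self (J : Finset (Fin n → Fin d)) :
    (wordProjection X J : Composite (Fin n → Fin d) E →L[ℂ] _) ∘L wordProjection X J =
      wordProjection X J := by
  nth_rw 1 [wordProjection]
  rw [finsetSum_comp]
  nth_rw 2 [wordProjection]
  refine Finset.sum_congr rfl fun j hj => ?_
  rw [comp_assoc, bra_comp_wordProjection]
  simp [star_productKet_dotProduct_self, hj]

theorem wordProjection_add_compl (J : Finset (Fin n → Fin d)) :
    (wordProjection X J : Composite (Fin n → Fin d) E →L[ℂ] _) + wordProjection X Jᶜ = 1 := by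
  rw [← wordProjection_univ X, wordProjection, wordProjection, wordProjection,
    Finset.sum_add_sum_compl]

theorem posTrace_sandwich_wordProjection (J : Finset (Fin n → Fin d))
    {ρ : Composite (Fin n → Fin d) E →L[ℂ] Composite (Fin n → Fin d) E} (hρ : 0 ≤ ρ) :
    posTrace (sandwich (wordProjection X J) ρ) =
      ∑ j ∈ J, posTrace (sandwich (bra (productKet X j)) ρ) := by
  have h := sum_posTrace_sandwich (ι := Unit) (κ := J) (fun _ => wordProjection X J)
    (fun j => (bra (productKet X j.1) : Composite (Fin n → Fin d) E →L[ℂ] E)) (by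
      simp only [adjoint_wordProjection, wordProjection_comp_self, Fintype.sum_unique]
      rw [wordProjection, ← Finset.sum_coe_sort]) hρ
  rw [Fintype.sum_unique] at h
  rw [h, Finset.sum_coe_sort J (fun j => posTrace (sandwich (bra (productKet X j)) ρ))]

theorem measured_eq_sum_sandwich
    (ρ : Composite (Fin n → Fin d) E →L[ℂ] Composite (Fin n → Fin d) E) :
    measured Z ρ = ∑ i, sandwich
      (adjoint (bra (productKet Z i)) ∘L bra (productKet Z i)) ρ := by
  simp only [measured, conjBy_eq_sandwich, adjoint_bra_comp_bra]

theorem posTrace_measured {ρ : Composite (Fin n → Fin d) E →L[ℂ] Composite (Fin n → Fin d) E}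
    (hρ : 0 ≤ ρ) : posTrace (measured Z ρ) = posTrace ρ := by
  rw [measured_eq_sum_sandwich, posTrace_sum _ _ fun i => sandwich_nonneg _ hρ]
  refine sum_posTrace_sandwich_of_resolution _ ?_ hρ
  rw [← wordProjection_univ Z, wordProjection]
  refine Finset.sum_congr rfl fun i _ => ?_
  have h : (bra (productKet Z i) : Composite (Fin n → Fin d) E →L[ℂ] E) ∘L
      adjoint (bra (productKet Z i)) = ContinuousLinearMap.id ℂ E := by
    rw [bra_comp_adjoint_bra, star_productKet_dotProduct_self, if_pos rfl, one_smul]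
  rw [adjoint_comp, adjoint_adjoint, comp_assoc, ← comp_assoc _ _ (bra _), h, id_comp]

theorem measured_mono {S T : Composite (Fin n → Fin d) E →L[ℂ] Composite (Fin n → Fin d) E}
    (h : S ≤ T) : measured Z S ≤ measured Z T := by
  simp only [measured_eq_sum_sandwich]
  exact Finset.sum_le_sum fun i _ => sandwich_mono _ h

theorem measured_nonneg {ρ : Composite (Fin n → Fin d) E →L[ℂ] Composite (Fin n → Fin d) E}
    (hρ : 0 ≤ ρ) : 0 ≤ measured Z ρ := by
  simp only [measured_eq_sum_sandwich]
  exact Finset.sum_nonneg fun i _ => sandwich_nonneg _ hρ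

theorem measured_sub (S T : Composite (Fin n → Fin d) E →L[ℂ] Composite (Fin n → Fin d) E) :
    measured Z (S - T) = measured Z S - measured Z T := by
  simp only [measured_eq_sum_sandwich, sandwich_sub, Finset.sum_sub_distrib]

theorem measured_neg (T : Composite (Fin n → Fin d) E →L[ℂ] Composite (Fin n → Fin d) E) :
    measured Z (-T) = -measured Z T := by
  simp only [measured_eq_sum_sandwich, sandwich_neg, Finset.sum_neg_distrib]

theorem measured_smul (c : ℂ)
    (T : Composite (Fin n → Fin d) E →L[ℂ] Composite (Fin n → Fin d) E) :
    measured Z (c • T) = c • measured Z T := by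
  simp only [measured_eq_sum_sandwich, sandwich_smul, Finset.smul_sum]

/-- Measuring is positive and trace preserving, so a two-sided operator bound survives it with the
same trace. -/
theorem traceNorm_measured_le {D Q : Composite (Fin n → Fin d) E →L[ℂ] Composite (Fin n → Fin d) E}
    (hQ : 0 ≤ Q) (h1 : D ≤ Q) (h2 : -D ≤ Q) : traceNorm (measured Z D) ≤ posTrace Q := by
  rw [← posTrace_measured Z hQ]
  refine traceNorm_le_posTrace (measured_mono Z h1) ?_
  rw [← measured_neg]
  exact measured_mono Z h2

/-- If the squared overlaps of the product vectors `|z_i⟩` and `|x_j⟩` are at most `κ`, then measuring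
a state supported on `|x_j⟩`, `j ∈ J`, in the basis `Z` gives at most `|J| κ (1 ⊗ tr_A)`. -/
theorem measured_sandwich_wordProjection_le (J : Finset (Fin n → Fin d)) {κ : ℝ}
    (hXZ : ∀ i j : Fin n → Fin d, ‖star (productKet Z i) ⬝ᵥ productKet X j‖ ^ 2 ≤ κ)
    {ρ : Composite (Fin n → Fin d) E →L[ℂ] Composite (Fin n → Fin d) E} (hρ : 0 ≤ ρ) :
    measured Z (sandwich (wordProjection X J) ρ) ≤ ((J.card * κ : ℝ) : ℂ) •
      opTensor (1 : Matrix (Fin n → Fin d) (Fin n → Fin d) ℂ)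
        (∑ j ∈ J, sandwich (bra (productKet X j)) ρ) := by
  set τ : E →L[ℂ] E := ∑ j ∈ J, sandwich (bra (productKet X j)) ρ with hτ
  -- Here `⟨z_i| P = ∑_{j ∈ J} ⟨z_i|x_j⟩ ⟨x_j|`, so Cauchy–Schwarz costs `|J|` and each overlap
  -- costs `κ`.
  have h1 : ∀ i, sandwich (bra (productKet Z i)) (sandwich (wordProjection X J) ρ) ≤
      ((J.card * κ : ℝ) : ℂ) • τ := by
    intro i
    rw [← sandwich_comp, bra_comp_wordProjection]
    refine (sandwich_sum_le J _ hρ).trans ?_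
    rw [Complex.ofReal_mul, mul_smul]
    refine ofReal_smul_le_smul (Nat.cast_nonneg _) ?_
    rw [hτ, Finset.smul_sum]
    refine Finset.sum_le_sum fun j _ => ?_
    rw [sandwich_smul_left]
    exact ofReal_smul_le_of_le (hXZ i j) (sandwich_nonneg _ hρ)
  rw [measured_eq_sum_sandwich]
  simp only [sandwich_comp]
  refine (Finset.sum_le_sum fun i _ => sandwich_mono _ (h1 i)).trans_eq ?_
  simp only [sandwich_smul, sandwich_adjoint_bra]
  rw [← Finset.smul_sum, ← sum_vecMulVec_productKet Z, opTensor_sum]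

end ProductKets

/-! ### Overlap exponent and the entropy bound for a single state -/

section Entropy

open ContinuousLinearMap
open scoped Matrix

variable {n d : ℕ} (X Z : OrthonormalBasis (Fin d) ℂ (EuclideanSpace ℂ (Fin d)))

theorem norm_inner_sq_le_two_rpow_overlapExponent (a b : Fin d) :
    ‖inner ℂ (Z a) (X b)‖ ^ 2 ≤ (2 : ℝ) ^ (-overlapExponent Z X) := by
  have hbdd : BddAbove (Set.range fun p : Fin d × Fin d => ‖inner ℂ (Z p.1) (X p.2)‖ ^ 2) :=
    Set.finite_range _ |>.bddAbove
  have hle := fun p => le_ciSup hbdd p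
  -- Positivity is needed to undo the logarithm. If all overlaps with `X b` vanished, Parseval in
  -- the basis `Z` would contradict `‖X b‖ = 1`.
  have hpos : 0 < ⨆ p : Fin d × Fin d, ‖inner ℂ (Z p.1) (X p.2)‖ ^ 2 := by
    by_contra hcon
    have h0 : ∀ i, ‖inner ℂ (Z i) (X b)‖ ^ 2 = 0 := fun i =>
      le_antisymm ((hle (i, b)).trans (not_lt.1 hcon)) (by positivity)
    have := Z.sum_sq_norm_inner_right (X b)
    simp [h0] at this
  rw [overlapExponent, neg_neg, Real.rpow_logb (by norm_num) (by norm_num) hpos]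
  exact hle (a, b)

theorem norm_star_productKet_dotProduct_sq_le (i j : Fin n → Fin d) :
    ‖star (productKet Z i) ⬝ᵥ productKet X j‖ ^ 2 ≤
      (2 : ℝ) ^ (-((n : ℝ) * overlapExponent Z X)) := by
  rw [star_productKet_dotProduct, norm_prod, ← Finset.prod_pow]
  refine (Finset.prod_le_prod (fun _ _ => by positivity) fun l _ =>
    norm_inner_sq_le_two_rpow_overlapExponent X Z (i l) (j l)).trans_eq ?_
  rw [Finset.prod_const, Finset.card_univ, Fintype.card_fin, ← Real.rpow_mul_natCast (by norm_num)]
  congr 1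
  ring

variable {E : Type*} [NormedAddCommGroup E] [InnerProductSpace ℂ E] [CompleteSpace E]

/-- The smoothing witness is the measured normalized projection `PρP / a`, and the witness on `E` is
`τ`, its reduced state. Both have trace one because `a` is the probability of passing `P`. -/
theorem le_smoothMinEntropyMeasured_add_log2Card
    {ρ : Composite (Fin n → Fin d) E →L[ℂ] Composite (Fin n → Fin d) E} (hρ : IsDensityOperator ρ)
    (J : Finset (Fin n → Fin d)) {a r : ℝ} (ha : 0 < a)
    (haJ : posTrace (sandwich (wordProjection X J) ρ) = ENNReal.ofReal a)
    (hr : 2 * √(1 - a) + 2 * (1 - a) ≤ r) :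
    ((((n : ℝ) * overlapExponent Z X : ℝ)) : EReal) ≤
      smoothMinEntropyMeasured r Z ρ + log2Card J.card := by
  have hρ0 : 0 ≤ ρ := (nonneg_iff_isPositive _).2 hρ.1
  have hai : (0 : ℝ) ≤ a⁻¹ := by positivity
  have hPρ := sandwich_nonneg (wordProjection X J) hρ0
  have hPρ' := sandwich_nonneg (wordProjection X Jᶜ) hρ0
  have hsum : posTrace (sandwich (wordProjection X J) ρ) +
      posTrace (sandwich (wordProjection X Jᶜ) ρ) = 1 := by
    have h := sum_posTrace_sandwich_of_resolution
      (fun i => (bra (productKet X i) : Composite (Fin n → Fin d) E →L[ℂ] E))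
      (wordProjection_univ X) hρ0
    rw [hρ.2] at h
    rw [posTrace_sandwich_wordProjection X J hρ0, posTrace_sandwich_wordProjection X Jᶜ hρ0,
      Finset.sum_add_sum_compl, h]
  have ha1 : a ≤ 1 := by
    rw [haJ] at hsum
    exact ENNReal.ofReal_le_one.1 (hsum ▸ le_self_add)
  have haJ' : posTrace (sandwich (wordProjection X Jᶜ) ρ) = ENNReal.ofReal (1 - a) := by
    rw [haJ] at hsum
    rw [ENNReal.ofReal_sub _ ha.le, ENNReal.ofReal_one, ← hsum,
      ENNReal.add_sub_cancel_left ENNReal.ofReal_ne_top]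
  -- An empty `J` would give passing probability `0`, so `a > 0` keeps `log₂ |J|` finite.
  have hJ : (0 : ℝ) < J.card := by
    rw [Nat.cast_pos, Finset.card_pos, Finset.nonempty_iff_ne_empty]
    rintro rfl
    rw [posTrace_sandwich_wordProjection X _ hρ0, Finset.sum_empty] at haJ
    exact (ENNReal.ofReal_pos.2 ha).ne haJ
  set σ := ((a⁻¹ : ℝ) : ℂ) • sandwich (wordProjection X J) ρ with hσ
  set τ : E →L[ℂ] E := ((a⁻¹ : ℝ) : ℂ) • ∑ j ∈ J, sandwich (bra (productKet X j)) ρ with hτ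
  have hinv : ENNReal.ofReal a⁻¹ * ENNReal.ofReal a = 1 := by
    rw [← ENNReal.ofReal_mul hai, inv_mul_cancel₀ ha.ne', ENNReal.ofReal_one]
  have hσ0 : 0 ≤ σ := ofReal_smul_nonneg hai hPρ
  have hσd : IsDensityOperator (measured Z σ) := by
    refine ⟨(nonneg_iff_isPositive _).1 (measured_nonneg Z hσ0), ?_⟩
    rw [posTrace_measured Z hσ0, hσ, posTrace_smul hai, haJ, hinv]
  have hτd : IsDensityOperator τ := by
    refine ⟨(nonneg_iff_isPositive _).1 (ofReal_smul_nonneg hai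
      (Finset.sum_nonneg fun j _ => sandwich_nonneg _ hρ0)), ?_⟩
    rw [hτ, posTrace_smul hai, posTrace_sum _ _ fun j => sandwich_nonneg _ hρ0,
      ← posTrace_sandwich_wordProjection X J hρ0, haJ, hinv]
  have hnear' : ∀ c : ℝ, 0 < c → traceNorm (measured Z ρ - measured Z σ) ≤
      ENNReal.ofReal (c + (2 + c⁻¹) * (1 - a)) := by
    intro c hc
    have h1a : 0 ≤ a⁻¹ - 1 := sub_nonneg.2 ((one_le_inv₀ ha).2 ha1)
    obtain ⟨h1, h2⟩ := gentle_measurement_bound hρ0 (adjoint_wordProjection X J)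
      (adjoint_wordProjection X Jᶜ) (wordProjection_add_compl X J) ha ha1 hc
    have hQ1 := ofReal_smul_nonneg (by positivity : 0 ≤ c + (a⁻¹ - 1)) hPρ
    have hQ2 := ofReal_smul_nonneg (by positivity : 0 ≤ 1 + c⁻¹) hPρ'
    rw [← measured_sub]
    refine (traceNorm_measured_le Z (add_nonneg hQ1 hQ2) h1 h2).trans ?_
    rw [posTrace_add hQ1 hQ2, posTrace_smul (by positivity), posTrace_smul (by positivity), haJ,
      haJ', ← ENNReal.ofReal_mul (by positivity), ← ENNReal.ofReal_mul (by positivity),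
      ← ENNReal.ofReal_add (by positivity)
        (mul_nonneg (by positivity) (sub_nonneg.2 ha1))]
    refine ENNReal.ofReal_le_ofReal ?_
    have e : (c + (a⁻¹ - 1)) * a = c * a + 1 - a := by
      field_simp
      ring
    rw [e]
    nlinarith
  -- The choice `c = √(1 - a)` balances `c` against `c⁻¹ (1 - a)`. For `a = 1` it would be zero, so
  -- there `c` tends to `0` instead.
  have hnear : traceNorm (measured Z ρ - measured Z σ) ≤ ENNReal.ofReal r := by
    rcases ha1.lt_or_eq with h | h
    · have h1 : 0 < 1 - a := sub_pos.2 h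
      refine (hnear' (√(1 - a)) (Real.sqrt_pos.2 h1)).trans
        (ENNReal.ofReal_le_ofReal (le_trans (le_of_eq ?_) hr))
      have h2 := Real.mul_self_sqrt h1.le
      have h3 : (√(1 - a))⁻¹ * (1 - a) = √(1 - a) := by
        nth_rw 2 [← h2]
        exact inv_mul_cancel_left₀ (Real.sqrt_pos.2 h1).ne' _
      linear_combination h3
    · refine ENNReal.le_of_forall_pos_le_add fun e he _ => (hnear' e he).trans ?_
      simp [h]
  set lam : ℝ := n * overlapExponent Z X - Real.logb 2 J.card with hlam
  have hle : measured Z σ ≤ (((2 : ℝ) ^ (-lam) : ℝ) : ℂ) • opTensor 1 τ := by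
    have h2 : (2 : ℝ) ^ (-lam) = J.card * (2 : ℝ) ^ (-((n : ℝ) * overlapExponent Z X)) := by
      rw [hlam, neg_sub, sub_eq_add_neg, Real.rpow_add (by norm_num),
        Real.rpow_logb (by norm_num) (by norm_num) hJ]
    rw [h2, hσ, hτ, measured_smul, opTensor_smul_right, smul_comm]
    exact ofReal_smul_le_smul hai (measured_sandwich_wordProjection_le X Z J
      (norm_star_productKet_dotProduct_sq_le X Z) hρ0)
  have hent : (lam : EReal) ≤ smoothMinEntropyMeasured r Z ρ := by
    refine le_iSup₂_of_le (measured Z σ) ⟨hσd, hnear⟩ (le_iSup₂_of_le τ hτd ?_)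
    refine le_sSup ⟨lam, ?_, rfl⟩
    rw [Set.mem_ofPred_eq]
    convert (le_def _ _).1 hle
  have hcard : J.card ≠ 0 := by exact_mod_cast hJ.ne'
  rw [log2Card, if_neg hcard]
  refine le_trans ?_ (add_le_add_left hent _)
  rw [← EReal.coe_add, hlam, sub_add_cancel]

end Entropy

/-! ### Splitting a word into its sampled and unsampled substrings -/

section Words

variable {N d : ℕ}

theorem prod_orderEmbOfFin (t : Finset (Fin N)) (f : Fin N → ℂ) :
    ∏ k, f (t.orderEmbOfFin rfl k) = ∏ l ∈ t, f l := by
  conv_rhs => rw [← Finset.map_orderEmbOfFin_univ t rfl]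
  rw [Finset.prod_map]
  rfl

theorem productKet_eq_mul (X : OrthonormalBasis (Fin d) ℂ (EuclideanSpace ℂ (Fin d)))
    (t : Finset (Fin N)) (i w : Fin N → Fin d) :
    productKet X i w =
      productKet X (substr t i) (substr t w) * productKet X (substr tᶜ i) (substr tᶜ w) := by
  have h := fun s : Finset (Fin N) => prod_orderEmbOfFin s fun l => X (i l) (w l)
  simp only [productKet, substr, h, Finset.prod_mul_prod_compl]

theorem bijective_substr (t : Finset (Fin N)) :
    Function.Bijective fun i : Fin N → Fin d => (substr t i, substr tᶜ i) := by
  rw [Fintype.bijective_iff_injective_and_card]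
  constructor
  · intro i j h
    have key : ∀ s : Finset (Fin N), substr s i = substr s j → ∀ l ∈ s, i l = j l := by
      intro s hs l hl
      have hl' : l ∈ Set.range (s.orderEmbOfFin rfl) := by
        rw [Finset.range_orderEmbOfFin]
        exact hl
      obtain ⟨k, rfl⟩ := hl'
      exact congrFun hs k
    funext l
    by_cases hl : l ∈ t
    · exact key t (congrArg Prod.fst h) l hl
    · exact key tᶜ (congrArg Prod.snd h) l (Finset.mem_compl.2 hl)
  · simp only [Fintype.card_prod, Fintype.card_fun, Fintype.card_fin]
    rw [← pow_add, Finset.card_add_card_compl, Fintype.card_fin]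

/-- A word is determined by its substrings on `t` and on the complement of `t`. -/
noncomputable def splitWord (t : Finset (Fin N)) :
    (Fin N → Fin d) ≃ (Fin t.card → Fin d) × (Fin tᶜ.card → Fin d) :=
  Equiv.ofBijective _ (bijective_substr t)

theorem splitWord_apply (t : Finset (Fin N)) (i : Fin N → Fin d) :
    splitWord t i = (substr t i, substr tᶜ i) := rfl

theorem mem_closeWords_iff_mem_goodWords {k : ℕ} (Ψ : SamplingStrategy N d k) (δ : ℝ)
    (t : Finset (Fin N)) (i : Fin N → Fin d) :
    substr tᶜ i ∈ Ψ.closeWords δ tᶜ.card (substr t i) ↔ i ∈ Ψ.goodWords δ t := by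
  simp [SamplingStrategy.closeWords, SamplingStrategy.goodWords]

end Words

/-! ### Outcome probabilities as marginals of one distribution on words -/

section Outcomes

open ContinuousLinearMap
open scoped Matrix

variable {N d k : ℕ}
variable {E : Type*} [NormedAddCommGroup E] [InnerProductSpace ℂ E] [CompleteSpace E]
variable (X : OrthonormalBasis (Fin d) ℂ (EuclideanSpace ℂ (Fin d)))

/-- The operator `⟨x_q|_{A_t} ⊗ 1_{A_{-t}}`. -/
noncomputable def partialBra (t : Finset (Fin N)) (q : Fin t.card → Fin d) :
    Matrix (Fin tᶜ.card → Fin d) (Fin N → Fin d) ℂ :=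
  Matrix.of fun w' w => if substr tᶜ w = w' then star (productKet X q (substr t w)) else 0

theorem outcomeOperator_mul_attachSubset (t t' : Finset (Fin N)) (q : Fin t.card → Fin d) :
    outcomeOperator X t q * attachSubset (d := d) t' = if t' = t then partialBra X t q else 0 := by
  ext w' w
  rw [Matrix.mul_apply, Finset.sum_eq_single (t', w)]
  · by_cases h : t' = t
    · simp [outcomeOperator, attachSubset, partialBra, h]
    · simp [outcomeOperator, h]
  · rintro ⟨s, v⟩ _ h
    have : ¬(s = t' ∧ v = w) := fun h' => h (Prod.ext h'.1 h'.2)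
    simp only [attachSubset, Matrix.of_apply, this, if_false, mul_zero]
  · simp

/-- Measuring the sampled qudits and then the others in `X` amounts to measuring all of them:
`⟨x_{i_{-t}}| ∘ ⟨x_{i_t}| = ⟨x_i|`. -/
theorem conjTranspose_partialBra_mulVec (t : Finset (Fin N)) (i : Fin N → Fin d) :
    (partialBra X t (substr t i))ᴴ *ᵥ productKet X (substr tᶜ i) = productKet X i := by
  ext w
  rw [productKet_eq_mul X t i w, Matrix.mulVec, dotProduct,
    Finset.sum_eq_single (substr tᶜ w)]
  · simp [partialBra]
  · intro v _ hv
    simp [partialBra, hv.symm]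
  · simp

theorem conjBy_outcomeOperator (P : PMF (Finset (Fin N)))
    (ρ : Composite (Fin N → Fin d) E →L[ℂ] Composite (Fin N → Fin d) E)
    (t : Finset (Fin N)) (q : Fin t.card → Fin d) :
    conjBy (outcomeOperator X t q) (withSubset P ρ) = (((P t).toReal : ℝ) : ℂ) •
      sandwich (opTensor (partialBra X t q) (ContinuousLinearMap.id ℂ E)) ρ := by
  simp only [withSubset, conjBy_eq_sandwich, sandwich_sum, sandwich_smul, ← sandwich_comp,
    opTensor_comp, outcomeOperator_mul_attachSubset, comp_id]
  rw [Finset.sum_eq_single t]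
  · rw [if_pos rfl]
  · intro s _ hs
    rw [if_neg hs, opTensor_zero, sandwich, zero_comp, smul_zero]
  · exact fun h => absurd (Finset.mem_univ t) h

/-- The probability of the word `i` if all qudits of `ρ` are measured in the basis `X`. -/
noncomputable def wordProb (ρ : Composite (Fin N → Fin d) E →L[ℂ] Composite (Fin N → Fin d) E)
    (i : Fin N → Fin d) : ℝ :=
  (posTrace (sandwich (bra (productKet X i)) ρ)).toReal

variable {ρ : Composite (Fin N → Fin d) E →L[ℂ] Composite (Fin N → Fin d) E}

theorem sum_posTrace_sandwich_bra (hρ : IsDensityOperator ρ) :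
    ∑ i, posTrace (sandwich (bra (productKet X i)) ρ) = 1 := by
  refine Eq.trans ?_ hρ.2
  exact sum_posTrace_sandwich_of_resolution
    (fun i => (bra (productKet X i) : Composite (Fin N → Fin d) E →L[ℂ] E))
    (wordProjection_univ X) ((nonneg_iff_isPositive _).2 hρ.1)

theorem ofReal_wordProb (hρ : IsDensityOperator ρ) (i : Fin N → Fin d) :
    ENNReal.ofReal (wordProb X ρ i) = posTrace (sandwich (bra (productKet X i)) ρ) := by
  have h : ∑ i, posTrace (sandwich (bra (productKet X i)) ρ) ≠ ∞ :=
    (sum_posTrace_sandwich_bra X hρ).trans_ne ENNReal.one_ne_top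
  rw [wordProb, ENNReal.ofReal_toReal (ENNReal.sum_ne_top.1 h i (Finset.mem_univ i))]

theorem wordProb_nonneg (i : Fin N → Fin d) : 0 ≤ wordProb X ρ i := ENNReal.toReal_nonneg

theorem sum_wordProb (hρ : IsDensityOperator ρ) : ∑ i, wordProb X ρ i = 1 := by
  rw [← ENNReal.ofReal_eq_one, ENNReal.ofReal_sum_of_nonneg fun i _ => wordProb_nonneg X i]
  simp only [ofReal_wordProb X hρ, sum_posTrace_sandwich_bra X hρ]

theorem posTrace_wordProjection_partialBra (hρ : IsDensityOperator ρ) (t : Finset (Fin N))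
    (q : Fin t.card → Fin d) (J : Finset (Fin tᶜ.card → Fin d)) :
    posTrace (sandwich (wordProjection X J)
      (sandwich (opTensor (partialBra X t q) (ContinuousLinearMap.id ℂ E)) ρ)) =
      ENNReal.ofReal (∑ j ∈ J, wordProb X ρ ((splitWord t).symm (q, j))) := by
  have hρ0 : 0 ≤ ρ := (nonneg_iff_isPositive _).2 hρ.1
  rw [posTrace_sandwich_wordProjection X J (sandwich_nonneg _ hρ0),
    ENNReal.ofReal_sum_of_nonneg fun i _ => wordProb_nonneg X _]
  refine Finset.sum_congr rfl fun j _ => ?_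
  obtain ⟨i, hi⟩ := (splitWord t).surjective (q, j)
  rw [← hi, Equiv.symm_apply_apply, ofReal_wordProb X hρ, ← sandwich_comp, bra_comp_opTensor]
  rw [splitWord_apply, Prod.mk.injEq] at hi
  rw [← hi.1, ← hi.2, conjTranspose_partialBra_mulVec]

theorem posTrace_partialBra (hρ : IsDensityOperator ρ) (t : Finset (Fin N))
    (q : Fin t.card → Fin d) :
    posTrace (sandwich (opTensor (partialBra X t q) (ContinuousLinearMap.id ℂ E)) ρ) =
      ENNReal.ofReal (∑ j, wordProb X ρ ((splitWord t).symm (q, j))) := by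
  have h := posTrace_wordProjection_partialBra X hρ t q Finset.univ
  rwa [wordProjection_univ, sandwich_one] at h

theorem outcomeProb_withSubset (P : PMF (Finset (Fin N))) (hρ : IsDensityOperator ρ)
    (t : Finset (Fin N)) (q : Fin t.card → Fin d) :
    outcomeProb (withSubset P ρ) X t q =
      (P t).toReal * ∑ j, wordProb X ρ ((splitWord t).symm (q, j)) := by
  rw [outcomeProb, conjBy_outcomeOperator, posTrace_smul ENNReal.toReal_nonneg,
    posTrace_partialBra X hρ, ENNReal.toReal_mul, ENNReal.toReal_ofReal ENNReal.toReal_nonneg,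
    ENNReal.toReal_ofReal (Finset.sum_nonneg fun j _ => wordProb_nonneg X _)]

theorem outcomeProb_nonneg (P : PMF (Finset (Fin N))) (t : Finset (Fin N))
    (q : Fin t.card → Fin d) : 0 ≤ outcomeProb (withSubset P ρ) X t q :=
  ENNReal.toReal_nonneg

theorem isDensityOperator_postState (P : PMF (Finset (Fin N))) (hρ : IsDensityOperator ρ)
    {t : Finset (Fin N)} {q : Fin t.card → Fin d} (h : 0 < outcomeProb (withSubset P ρ) X t q) :
    IsDensityOperator (postState (withSubset P ρ) X t q) := by
  have hpos : 0 ≤ conjBy (outcomeOperator X t q) (withSubset P ρ) := by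
    rw [conjBy_outcomeOperator]
    exact ofReal_smul_nonneg ENNReal.toReal_nonneg
      (sandwich_nonneg _ ((nonneg_iff_isPositive _).2 hρ.1))
  have hinv : 0 ≤ (outcomeProb (withSubset P ρ) X t q)⁻¹ := inv_nonneg.2 h.le
  refine ⟨(nonneg_iff_isPositive _).1 (ofReal_smul_nonneg hinv hpos), ?_⟩
  have htop : posTrace (conjBy (outcomeOperator X t q) (withSubset P ρ)) ≠ ∞ := by
    intro htop
    rw [outcomeProb, htop, ENNReal.toReal_top] at h
    exact lt_irrefl _ h
  rw [postState, posTrace_smul hinv, ← ENNReal.ofReal_toReal htop]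
  change ENNReal.ofReal _ * ENNReal.ofReal (outcomeProb (withSubset P ρ) X t q) = 1
  rw [← ENNReal.ofReal_mul hinv, inv_mul_cancel₀ h.ne', ENNReal.ofReal_one]

/-- The probability that the experiment has outcome `(t, q)` and that a measurement of the remaining
qudits in the basis `X` gives a word outside `J_q`. -/
noncomputable def farProb (Ψ : SamplingStrategy N d k) (δ : ℝ)
    (ρ : Composite (Fin N → Fin d) E →L[ℂ] Composite (Fin N → Fin d) E)
    (t : Finset (Fin N)) (q : Fin t.card → Fin d) : ℝ :=
  (Ψ.subsetLaw t).toReal *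
    ∑ j ∈ (Ψ.closeWords δ tᶜ.card q)ᶜ, wordProb X ρ ((splitWord t).symm (q, j))

theorem farProb_nonneg (Ψ : SamplingStrategy N d k) (δ : ℝ) (t : Finset (Fin N))
    (q : Fin t.card → Fin d) : 0 ≤ farProb X Ψ δ ρ t q :=
  mul_nonneg ENNReal.toReal_nonneg (Finset.sum_nonneg fun _ _ => wordProb_nonneg X _)

theorem sum_subsetLaw_toReal (P : PMF (Finset (Fin N))) : ∑ t, (P t).toReal = 1 := by
  rw [← ENNReal.toReal_sum fun t _ => P.apply_ne_top t, ← tsum_fintype (L := .unconditional _),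
    P.tsum_coe, ENNReal.toReal_one]

theorem sum_outcomeProb (P : PMF (Finset (Fin N))) (hρ : IsDensityOperator ρ) :
    ∑ t, ∑ q, outcomeProb (withSubset P ρ) X t q = 1 := by
  rw [← sum_subsetLaw_toReal P]
  refine Finset.sum_congr rfl fun t _ => ?_
  simp only [outcomeProb_withSubset X P hρ]
  have h := (splitWord t).symm.sum_comp (wordProb X ρ)
  rw [Fintype.sum_prod_type, sum_wordProb X hρ] at h
  rw [← Finset.mul_sum, h, mul_one]

/-- The word law `wordProb` is the same for every `t`, so after exchanging the sums this is an
average over words of failure probabilities, each at most the maximum. -/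
theorem sum_farProb_le_errorProb (Ψ : SamplingStrategy N d k) (δ : ℝ) (hρ : IsDensityOperator ρ) :
    ∑ t, ∑ q, farProb X Ψ δ ρ t q ≤ Ψ.errorProb δ := by
  classical
  have h1 : ∀ t, ∑ q, farProb X Ψ δ ρ t q =
      ∑ i, wordProb X ρ i * if i ∉ Ψ.goodWords δ t then (Ψ.subsetLaw t).toReal else 0 := by
    intro t
    rw [← (splitWord t).symm.sum_comp, Fintype.sum_prod_type]
    refine Finset.sum_congr rfl fun q _ => ?_
    have hc : (Ψ.closeWords δ tᶜ.card q)ᶜ =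
        Finset.univ.filter fun j => (splitWord t).symm (q, j) ∉ Ψ.goodWords δ t := by
      ext j
      obtain ⟨i, hi⟩ := (splitWord t).surjective (q, j)
      rw [Finset.mem_compl, Finset.mem_filter, ← hi, Equiv.symm_apply_apply,
        ← mem_closeWords_iff_mem_goodWords]
      rw [splitWord_apply, Prod.mk.injEq] at hi
      simp [hi.1, hi.2]
    rw [farProb, hc, Finset.sum_filter, Finset.mul_sum]
    refine Finset.sum_congr rfl fun j _ => ?_
    split_ifs <;> ring
  simp only [h1]
  rw [Finset.sum_comm]
  simp only [← Finset.mul_sum]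
  have hle : ∀ i : Fin N → Fin d,
      (∑ t, if i ∉ Ψ.goodWords δ t then (Ψ.subsetLaw t).toReal else 0) ≤ Ψ.errorProb δ := by
    intro i
    refine le_trans (le_of_eq ?_) (le_ciSup (Set.finite_range _).bddAbove i)
    exact Finset.sum_congr rfl fun t _ => by congr
  refine (Finset.sum_le_sum fun i _ =>
    mul_le_mul_of_nonneg_left (hle i) (wordProb_nonneg X i)).trans_eq ?_
  rw [← Finset.sum_mul, sum_wordProb X hρ, one_mul]

/-- The min-entropy bound holds after every outcome for which words outside `J_q` are unlikely. -/
theorem minEntropy_bound_of_farProb_le (Z : OrthonormalBasis (Fin d) ℂ (EuclideanSpace ℂ (Fin d)))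
    (Ψ : SamplingStrategy N d k) (δ : ℝ) (hρ : IsDensityOperator ρ) {s r : ℝ} (hs : s < 1)
    (hr : 2 * √s + 2 * s ≤ r) {t : Finset (Fin N)} {q : Fin t.card → Fin d}
    (hpos : 0 < outcomeProb (withSubset Ψ.subsetLaw ρ) X t q)
    (hfar : farProb X Ψ δ ρ t q ≤ s * outcomeProb (withSubset Ψ.subsetLaw ρ) X t q) :
    (((((N : ℝ) - (t.card : ℝ)) * overlapExponent Z X : ℝ)) : EReal) ≤
      smoothMinEntropyMeasured r Z (postState (withSubset Ψ.subsetLaw ρ) X t q)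
        + log2Card (Ψ.closeWords δ tᶜ.card q).card := by
  have hN : (N : ℝ) - (t.card : ℝ) = (tᶜ.card : ℝ) := by
    have h := Finset.card_add_card_compl t
    rw [Fintype.card_fin] at h
    have h' : (t.card : ℝ) + tᶜ.card = N := by exact_mod_cast h
    linarith
  have hden := isDensityOperator_postState X Ψ.subsetLaw hρ hpos
  set J := Ψ.closeWords δ tᶜ.card q with hJ
  set π := outcomeProb (withSubset Ψ.subsetLaw ρ) X t q with hπ
  -- `g` is the joint probability of the outcome and of a remaining word in `J`. Thus `g / π` is the
  -- passing probability `a`, and `1 - a` is `farProb / π`.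
  set g : ℝ := (Ψ.subsetLaw t).toReal * ∑ j ∈ J, wordProb X ρ ((splitWord t).symm (q, j)) with hg
  have hsum : g + farProb X Ψ δ ρ t q = π := by
    rw [hg, hπ, farProb, ← mul_add, Finset.sum_add_sum_compl, outcomeProb_withSubset X _ hρ]
  have h1 : 1 - π⁻¹ * g ≤ s := by
    have : 1 - π⁻¹ * g = farProb X Ψ δ ρ t q / π := by
      rw [← hsum] at hpos ⊢
      field_simp
      ring
    rw [this, div_le_iff₀ hpos]
    exact hfar
  rw [hN]
  refine le_smoothMinEntropyMeasured_add_log2Card X Z hden J (a := π⁻¹ * g) (by linarith) ?_ ?_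
  · rw [postState, conjBy_outcomeOperator, smul_smul, ← Complex.ofReal_mul, sandwich_smul,
      posTrace_smul (by positivity), posTrace_wordProjection_partialBra X hρ,
      ← ENNReal.ofReal_mul (by positivity), hg, mul_assoc]
  · have := Real.sqrt_le_sqrt h1
    linarith

end Outcomes

/-! ### Markov's inequality over the outcomes and the choice of parameters -/

theorem mainTheorem1 {N d k : ℕ} (hd : 2 ≤ d)
    {E : Type*} [NormedAddCommGroup E] [InnerProductSpace ℂ E] [CompleteSpace E]
    (β : ℝ) (hβ0 : 0 < β) (hβ1 : β < 1 / 2)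
    (Ψ : SamplingStrategy N d k) (δ : ℝ) (hδ : 0 < δ)
    (ε : ℝ) (hε : ε = √(Ψ.errorProb δ))
    (ρ : Composite (Fin N → Fin d) E →L[ℂ] Composite (Fin N → Fin d) E)
    (hρ : IsDensityOperator ρ)
    (Z X : OrthonormalBasis (Fin d) ℂ (EuclideanSpace ℂ (Fin d))) :
    1 - 2 * ε ^ (1 - 2 * β) ≤
      experimentPr (withSubset Ψ.subsetLaw ρ) X (fun t q =>
        (((((N : ℝ) - (t.card : ℝ)) * overlapExponent Z X : ℝ)) : EReal) ≤
          smoothMinEntropyMeasured (4 * ε + 2 * ε ^ β) Z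
              (postState (withSubset Ψ.subsetLaw ρ) X t q)
            + log2Card (Ψ.closeWords δ tᶜ.card q).card) := by
  classical
  have hε0 : 0 ≤ ε := hε ▸ Real.sqrt_nonneg _
  have herr : ∑ t, ∑ q, farProb X Ψ δ ρ t q ≤ ε ^ 2 := by
    rw [hε, Real.sq_sqrt]
    · exact sum_farProb_le_errorProb X Ψ δ hρ
    · refine Real.iSup_nonneg fun i => Finset.sum_nonneg fun t _ => ?_
      split_ifs
      · exact le_rfl
      · exact ENNReal.toReal_nonneg
  have hprob0 := outcomeProb_nonneg X (ρ := ρ) Ψ.subsetLaw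
  have hfar0 := farProb_nonneg X (ρ := ρ) Ψ δ
  rcases le_or_gt (1 / 2) (ε ^ (1 - 2 * β)) with hbig | hsmall
  -- Here the claimed lower bound is at most `0`. Otherwise `ε < 1 / 2`, as `ε ≤ ε ^ (1 - 2β)` for
  -- `ε < 1`.
  · refine le_trans (by linarith : _ ≤ (0 : ℝ)) ?_
    refine Finset.sum_nonneg fun t _ => Finset.sum_nonneg fun q _ => ?_
    split_ifs
    · exact hprob0 t q
    · exact le_rfl
  have hε2 : ε < 1 / 2 := by
    have hε1 : ε < 1 := by
      by_contra h
      have := Real.one_le_rpow (not_lt.1 h) (by linarith : 0 ≤ 1 - 2 * β)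
      linarith
    rcases hε0.eq_or_lt with h | h
    · linarith
    · have := Real.rpow_le_rpow_of_exponent_ge h hε1.le (by linarith : 1 - 2 * β ≤ 1)
      rw [Real.rpow_one] at this
      linarith
  set y : ℝ := ε ^ β with hy
  have hy0 : 0 ≤ y := Real.rpow_nonneg hε0 β
  have hy1 : y ≤ 1 := Real.rpow_le_one hε0 (by linarith) hβ0.le
  -- The Markov threshold is chosen so that `ε ^ 2 / s = 2 ε ^ (1 - 2β)`; `ε < 1 / 2` then gives `√s
  -- ≤ ε ^ β / 2`.
  set s : ℝ := y ^ 2 * ε / 2 with hs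
  have hy2 : y ^ 2 ≤ y := by nlinarith
  have hsy : s ≤ (y / 2) ^ 2 := by
    have := mul_le_mul_of_nonneg_left hε2.le (sq_nonneg y)
    rw [hs]
    linarith
  have hsqrt : √s ≤ y / 2 := Real.sqrt_le_iff.2 ⟨by linarith, hsy⟩
  have hs1 : s < 1 := by nlinarith
  have hr : 2 * √s + 2 * s ≤ 4 * ε + 2 * y := by nlinarith
  have hgood := fun (t : Finset (Fin N)) (q : Fin t.card → Fin d) =>
    minEntropy_bound_of_farProb_le X Z Ψ δ hρ hs1 hr (t := t) (q := q)
  set event := fun (t : Finset (Fin N)) (q : Fin t.card → Fin d) =>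
    (((((N : ℝ) - (t.card : ℝ)) * overlapExponent Z X : ℝ)) : EReal) ≤
      smoothMinEntropyMeasured (4 * ε + 2 * y) Z (postState (withSubset Ψ.subsetLaw ρ) X t q)
        + log2Card (Ψ.closeWords δ tᶜ.card q).card
  -- Markov's factor is `1 / s`. For `ε = 0` also `s = 0`, but then every `farProb` vanishes and no
  -- factor is needed.
  set C : ℝ := if ε = 0 then 0 else s⁻¹ with hC
  -- Markov's inequality termwise: when the event fails at an outcome of positive probability,
  -- `farProb > s * outcomeProb`, so the left side is at most `0`.
  have hterm : ∀ t q, outcomeProb (withSubset Ψ.subsetLaw ρ) X t q - C * farProb X Ψ δ ρ t q ≤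
      if event t q then outcomeProb (withSubset Ψ.subsetLaw ρ) X t q else 0 := by
    intro t q
    have hsC : 0 ≤ C := by
      rw [hC]
      split_ifs
      · exact le_rfl
      · positivity
    split_ifs with he
    · have := mul_nonneg hsC (hfar0 t q)
      linarith
    · rcases (hprob0 t q).eq_or_lt with h0 | hpos
      · have := mul_nonneg hsC (hfar0 t q)
        linarith
      · have hlt := not_le.1 fun hle => he (hgood t q hpos hle)
        rcases hε0.eq_or_lt with h | h
        · exfalso
          have hs0 : s = 0 := by rw [hs, ← h]; ring
          rw [hs0, zero_mul] at hlt
          have h1 : farProb X Ψ δ ρ t q ≤ ∑ t, ∑ q, farProb X Ψ δ ρ t q :=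
            (Finset.single_le_sum (f := fun q => farProb X Ψ δ ρ t q) (fun q _ => hfar0 t q)
              (Finset.mem_univ q)).trans
              (Finset.single_le_sum (f := fun t => ∑ q, farProb X Ψ δ ρ t q)
                (fun t _ => Finset.sum_nonneg fun q _ => hfar0 t q) (Finset.mem_univ t))
          rw [← h] at herr
          linarith
        · have hy' : 0 < y := Real.rpow_pos_of_pos h β
          have hs' : 0 < s := by positivity
          rw [hC, if_neg h.ne', sub_nonpos, inv_mul_eq_div, le_div_iff₀ hs', mul_comm]
          exact hlt.le
  have hCε : C * ε ^ 2 ≤ 2 * ε ^ (1 - 2 * β) := by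
    rw [hC]
    split_ifs with h
    · rw [zero_mul]
      positivity
    · have h : 0 < ε := lt_of_le_of_ne hε0 (Ne.symm h)
      have hy' : 0 < y := Real.rpow_pos_of_pos h β
      rw [Real.rpow_sub h, Real.rpow_one, mul_comm 2 β, Real.rpow_mul hε0, Real.rpow_two, ← hy, hs]
      apply le_of_eq
      field_simp
  have hC0 : 0 ≤ C := by
    rw [hC]
    split_ifs <;> positivity
  calc 1 - 2 * ε ^ (1 - 2 * β)
      ≤ 1 - C * ∑ t, ∑ q, farProb X Ψ δ ρ t q := by
        have := mul_le_mul_of_nonneg_left herr hC0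
        linarith
    _ = ∑ t, ∑ q, (outcomeProb (withSubset Ψ.subsetLaw ρ) X t q - C * farProb X Ψ δ ρ t q) := by
        simp only [Finset.sum_sub_distrib, ← Finset.mul_sum, sum_outcomeProb X Ψ.subsetLaw hρ]
    _ ≤ _ := by
        rw [experimentPr]
        refine Finset.sum_le_sum fun t _ => Finset.sum_le_sum fun q _ => ?_
        refine (hterm t q).trans_eq ?_
        congr
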